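/- **Lemma 2.1.** Let $n\ge 0$ and $s_n=\tfrac12 n(n+1)$. Let $(M,g)$ be a $C^\infty$ Riemannian manifold that is diffeomorphic to $\mathbb R^n$, and let $\Gamma$ be an $n$-dimensional Bieberbach group (a torsion-free group isomorphic to a discrete cocompact subgroup of $\mathrm{Isom}(\mathbb R^n)$) that acts on $(M,g)$ by smooth isometries, properly discontinuously and with compact quotient $M/\Gamma$. Then there exists a $C^\infty$ embedding $u_0:M\to\mathbb R^{s_n+2n}$ such that 1. $u_0$ is free: at every point of $M$ and in every smooth local coordinate system $(x_1,\dots,x_n)$ around it, the $n+s_n$ vectors $\partial_i u_0$ $(1\le i\le n)$ and $\partial_i\partial_j u_0$ $(1\le i\le j\le n)$ are linearly independent; 2. $u_0$ is $\Gamma$-equivariant: there is a homomorphism $\rho:\Gamma\to\mathrm{Isom}(\mathbb R^{s_n+2n})$ with $u_0(\gamma x)=\rho(\gamma)\,u_0(x)$ for all $\gamma\in\Gamma$, $x\in M$; 3. $u_0$ is short: the symmetric $2$-tensor field $g-du_0\cdot du_0$ is positive-definite at every point of $M$, where $\cdot$ is the Euclidean inner product. -/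

import Mathlib

open Set Manifold
open scoped ContDiff

noncomputable section

namespace EquivariantEmbedding

/-- Euclidean space `ℝ^k` with its standard inner product. -/
abbrev Euc (k : ℕ) : Type := EuclideanSpace ℝ (Fin k)

/-- The number `s_n = n (n + 1) / 2` (the product is even, so the division is exact). -/
def s (n : ℕ) : ℕ := n * (n + 1) / 2

/-- `Γ` is an `n`-dimensional Bieberbach group: it is torsion-free and isomorphic to a discrete
cocompact group of isometries of `ℝ^n`. The embedding into the isometry group is `σ`; isometries
of `ℝ^n` onto itself are affine. A group of isometries of `ℝ^n` is discrete exactly when it acts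
properly discontinuously, and it is cocompact exactly when the translates of some compact set
cover `ℝ^n`. -/
def IsBieberbachGroup (n : ℕ) (Γ : Type*) [Group Γ] : Prop :=
  (∀ γ : Γ, γ ≠ 1 → ¬ IsOfFinOrder γ) ∧
  ∃ σ : Γ →* (Euc n ≃ᵃⁱ[ℝ] Euc n), Function.Injective σ ∧
    (∀ K : Set (Euc n), IsCompact K → {γ : Γ | (σ γ '' K ∩ K).Nonempty}.Finite) ∧
    ∃ K : Set (Euc n), IsCompact K ∧ ⋃ γ : Γ, σ γ '' K = univ

/-- The `i`-th partial derivative of a function of `n` real variables. -/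
def partialDeriv {n q : ℕ} (i : Fin n) (f : Euc n → Euc q) : Euc n → Euc q :=
  fun y => fderiv ℝ f y (EuclideanSpace.single i 1)

/-- The `n + s_n` vectors `∂_i f (y)`, `1 ≤ i ≤ n`, and `∂_i ∂_j f (y)`, `1 ≤ i ≤ j ≤ n`. -/
def twoJet {n q : ℕ} (f : Euc n → Euc q) (y : Euc n) :
    Fin n ⊕ {p : Fin n × Fin n // p.1 ≤ p.2} → Euc q :=
  Sum.elim (fun i => partialDeriv i f y)
    (fun p => partialDeriv p.1.1 (partialDeriv p.1.2 f) y)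

/-- `u : M → ℝ^q` is equivariant for the action of `Γ` on `M`: there is an action `ρ` of `Γ` on
`ℝ^q` by isometries with `u (γ x) = ρ(γ) (u x)`. -/
def IsEquivariant (Γ : Type*) [Group Γ] {M : Type*} [MulAction Γ M] {q : ℕ}
    (u : M → Euc q) : Prop :=
  ∃ ρ : Γ →* (Euc q ≃ᵃⁱ[ℝ] Euc q), ∀ (γ : Γ) (x : M), u (γ • x) = ρ γ (u x)

section Manifold

variable {n : ℕ} {M : Type*} [TopologicalSpace M] [ChartedSpace (Euc n) M]

variable (n) in
/-- A map `u : M → ℝ^q` is free if at every point of `M`, and in every smooth chart around it, its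
first and second order partial derivatives are linearly independent. -/
def IsFreeMap {q : ℕ} (u : M → Euc q) : Prop :=
  ∀ φ ∈ IsManifold.maximalAtlas (𝓡 n) ∞ M, ∀ x ∈ φ.source,
    LinearIndependent ℝ (twoJet (u ∘ φ.symm) (φ x))

/-- The symmetric bilinear form `du · du` on the tangent spaces of `M`. -/
def inducedForm {q : ℕ} (u : M → Euc q) (x : M) (v w : TangentSpace (𝓡 n) x) : ℝ :=
  inner (E := Euc q) ℝ (mfderiv (𝓡 n) (𝓡 q) u x v) (mfderiv (𝓡 n) (𝓡 q) u x w)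

variable [IsManifold (𝓡 n) ∞ M]

variable (n M) in
/-- Smooth Riemannian metrics on the `n`-dimensional manifold `M`. -/
abbrev RiemMetric : Type _ :=
  Bundle.ContMDiffRiemannianMetric (𝓡 n) ∞ (Euc n) (fun x : M => TangentSpace (𝓡 n) x)

/-- `g - du · du` is positive-definite at every point of `M`. -/
def IsShort (g : RiemMetric n M) {q : ℕ} (u : M → Euc q) : Prop :=
  ∀ (x : M) (v : TangentSpace (𝓡 n) x), v ≠ 0 → 0 < g.inner x v v - inducedForm u x v v

/-- The group `Γ` acts on `M` by smooth maps that preserve the Riemannian metric `g`. -/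
def ActsByIsometries (Γ : Type*) [Group Γ] [MulAction Γ M] (g : RiemMetric n M) : Prop :=
  ∀ γ : Γ, ContMDiff (𝓡 n) (𝓡 n) ∞ (fun x : M => γ • x) ∧
    ∀ (x : M) (v w : TangentSpace (𝓡 n) x),
      g.inner (γ • x) (mfderiv (𝓡 n) (𝓡 n) (fun y : M => γ • y) x v)
        (mfderiv (𝓡 n) (𝓡 n) (fun y : M => γ • y) x w) = g.inner x v w

end Manifold

end EquivariantEmbedding

end

/-! Transport the action to `ℝ^n` through the diffeomorphism, and let `Γ` act on `ℝ^q`, `q = s n + 2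
* n`, by its Bieberbach action on the first `n` coordinates and trivially on the others. Take a
cutoff `χ` whose translates sum to one, and a polynomial map `P` from `ℝ^n` to `ℝ^q` with
coefficient vector `a`. Averaging gives `u_a(x) = ∑ χ(γ⁻¹x) ρ(γ) P(γ⁻¹x)`, which is equivariant
because isometries are affine and the weights sum to one; it depends affinely on `a`.

A generic `a` works, by a dimension count. Failure of freeness is a nontrivial relation among the `n
+ s n` derivatives at a point: once one coefficient is normalized to 1, it is `q` equations in `(n +
s n - 1) + n = q - 1` unknowns. A coincidence of values on two orbits is `q` equations in `2 * n <
q` unknowns. When the linear part in `a` is onto, the bad parameters have Hausdorff dimension below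
that of the parameter space (`dimH_zeros_le`). Surjectivity is polynomial interpolation along
finitely many orbit points, with a degree fixed in advance (`surjective_diffOp_linFamily`,
`surjective_linFamily_sub`).

On a single orbit injectivity follows from freeness of the Bieberbach action, and its proper
discontinuity makes `u_a` proper (`exists_equivariant_free_embedding`). Finally `du · du` and `g`
are both invariant, so compactness of the quotient bounds one by a multiple of the other, and a
small homothety makes the map short (`exists_isShort_smul`) while keeping all other properties. -/

noncomputable section

namespace EquivariantEmbedding

open Filter Topology Module

/-! ### Two-jets and differential operators of order two on `ℝ^n`. -/

section Jets

variable {n : ℕ} {F G : Type*} [NormedAddCommGroup F] [NormedSpace ℝ F]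
  [NormedAddCommGroup G] [NormedSpace ℝ G]

/-- The indices of the partial derivatives of orders one and two. -/
abbrev JetIndex (n : ℕ) : Type := Fin n ⊕ {p : Fin n × Fin n // p.1 ≤ p.2}

/-- The `i`-th partial derivative of a map into a normed space. -/
def pd (i : Fin n) (f : Euc n → F) : Euc n → F :=
  fun y => fderiv ℝ f y (EuclideanSpace.single i 1)

/-- The partial derivatives of orders one and two of a map into a normed space. -/
def jet (f : Euc n → F) (y : Euc n) : JetIndex n → F :=
  Sum.elim (fun i => pd i f y) (fun p => pd p.1.1 (pd p.1.2 f) y)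

/-- The differential operator of order two, without constant term, with coefficients `c`. -/
def diffOp (c : JetIndex n → ℝ) (f : Euc n → F) (y : Euc n) : F := ∑ α, c α • jet f y α

theorem contDiff_pd {f : Euc n → F} (hf : ContDiff ℝ ∞ f) (i : Fin n) :
    ContDiff ℝ ∞ (pd i f) :=
  (hf.fderiv_right (m := ∞) (by simp)).clm_apply contDiff_const

theorem contDiff_jet {f : Euc n → F} (hf : ContDiff ℝ ∞ f) (α : JetIndex n) :
    ContDiff ℝ ∞ (fun y => jet f y α) := by
  rcases α with i | p
  · exact contDiff_pd hf i
  · exact contDiff_pd (contDiff_pd hf _) _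

theorem pd_eventuallyEq {f g : Euc n → F} {y : Euc n} (h : f =ᶠ[𝓝 y] g) (i : Fin n) :
    pd i f =ᶠ[𝓝 y] pd i g := by
  filter_upwards [h.fderiv (𝕜 := ℝ)] with z hz
  simp [pd, hz]

theorem jet_congr {f g : Euc n → F} {y : Euc n} (h : f =ᶠ[𝓝 y] g) : jet f y = jet g y := by
  funext α
  rcases α with i | p
  · exact (pd_eventuallyEq h i).eq_of_nhds
  · exact (pd_eventuallyEq (pd_eventuallyEq h _) _).eq_of_nhds

theorem diffOp_congr {f g : Euc n → F} {y : Euc n} (h : f =ᶠ[𝓝 y] g) (c : JetIndex n → ℝ) :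
    diffOp c f y = diffOp c g y := by
  rw [diffOp, diffOp, jet_congr h]

theorem pd_const (i : Fin n) (v : F) : pd i (fun _ : Euc n => v) = fun _ => 0 := by
  funext y; simp [pd]

theorem diffOp_const (c : JetIndex n → ℝ) (v : F) (y : Euc n) :
    diffOp c (fun _ : Euc n => v) y = 0 := by
  refine Finset.sum_eq_zero fun α _ => ?_
  rcases α with i | p <;> simp [jet, pd_const]

theorem pd_clm_comp (L : F →L[ℝ] G) {f : Euc n → F} (hf : ContDiff ℝ ∞ f) (i : Fin n) :
    pd i (fun z => L (f z)) = fun z => L (pd i f z) := by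
  funext y
  have h := L.hasFDerivAt.comp y (hf.differentiable (by simp) y).hasFDerivAt
  have h' : fderiv ℝ (fun z => L (f z)) y = _ := h.fderiv
  simp [pd, h']

theorem jet_clm_comp (L : F →L[ℝ] G) {f : Euc n → F} (hf : ContDiff ℝ ∞ f) (y : Euc n)
    (α : JetIndex n) : jet (fun z => L (f z)) y α = L (jet f y α) := by
  rcases α with i | p
  · exact congrFun (pd_clm_comp L hf i) y
  · change pd _ (pd _ _) y = _
    rw [pd_clm_comp L hf, pd_clm_comp L (contDiff_pd hf _)]
    rfl

theorem diffOp_clm_comp (L : F →L[ℝ] G) {f : Euc n → F} (hf : ContDiff ℝ ∞ f) (y : Euc n)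
    (c : JetIndex n → ℝ) : diffOp c (fun z => L (f z)) y = L (diffOp c f y) := by
  simp [diffOp, jet_clm_comp L hf]

theorem pd_add {f g : Euc n → F} (hf : ContDiff ℝ ∞ f) (hg : ContDiff ℝ ∞ g) (i : Fin n) :
    pd i (fun z => f z + g z) = fun z => pd i f z + pd i g z := by
  funext y
  have := fderiv_fun_add (hf.differentiable (by simp) y) (hg.differentiable (by simp) y)
  simp [pd, this]

theorem jet_add {f g : Euc n → F} (hf : ContDiff ℝ ∞ f) (hg : ContDiff ℝ ∞ g) (y : Euc n)
    (α : JetIndex n) : jet (fun z => f z + g z) y α = jet f y α + jet g y α := by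
  rcases α with i | p
  · exact congrFun (pd_add hf hg i) y
  · change pd _ (pd _ _) y = _
    rw [pd_add hf hg, pd_add (contDiff_pd hf _) (contDiff_pd hg _)]
    rfl

theorem diffOp_add {f g : Euc n → F} (hf : ContDiff ℝ ∞ f) (hg : ContDiff ℝ ∞ g) (y : Euc n)
    (c : JetIndex n → ℝ) :
    diffOp c (fun z => f z + g z) y = diffOp c f y + diffOp c g y := by
  simp [diffOp, jet_add hf hg, Finset.sum_add_distrib]

theorem diffOp_sum {ι : Type*} (t : Finset ι) {f : ι → Euc n → F}
    (hf : ∀ i, ContDiff ℝ ∞ (f i)) (y : Euc n) (c : JetIndex n → ℝ) :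
    diffOp c (fun z => ∑ i ∈ t, f i z) y = ∑ i ∈ t, diffOp c (f i) y := by
  classical
  induction t using Finset.induction_on with
  | empty => simpa using diffOp_const c (0 : F) y
  | insert i t hi ih =>
    simp only [Finset.sum_insert hi]
    rw [diffOp_add (hf i) (ContDiff.sum fun j _ => hf j), ih]

theorem pd_mul {f g : Euc n → ℝ} (hf : ContDiff ℝ ∞ f) (hg : ContDiff ℝ ∞ g) (i : Fin n) :
    pd i (fun z => f z * g z) = fun z => f z * pd i g z + pd i f z * g z := by
  funext y
  have := fderiv_fun_mul (hf.differentiable (by simp) y) (hg.differentiable (by simp) y)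
  simp [pd, this]; ring

theorem pd_pd_mul {f g : Euc n → ℝ} (hf : ContDiff ℝ ∞ f) (hg : ContDiff ℝ ∞ g) (i j : Fin n)
    (y : Euc n) : pd i (pd j (fun z => f z * g z)) y =
      f y * pd i (pd j g) y + pd i f y * pd j g y + pd j f y * pd i g y +
        pd i (pd j f) y * g y := by
  rw [pd_mul hf hg j, pd_add (hf.mul (contDiff_pd hg j)) ((contDiff_pd hf j).mul hg),
    pd_mul hf (contDiff_pd hg j), pd_mul (contDiff_pd hf j) hg]
  ring

/-- A differential operator of order two applied to a product one of whose factors vanishes to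
first order only sees the value of the other factor. -/
theorem diffOp_mul_of_vanish {f g : Euc n → ℝ} (hf : ContDiff ℝ ∞ f) (hg : ContDiff ℝ ∞ g)
    {y : Euc n} (h0 : g y = 0) (h1 : ∀ i, pd i g y = 0) (c : JetIndex n → ℝ) :
    diffOp c (fun z => f z * g z) y = f y * diffOp c g y := by
  rw [diffOp, diffOp, Finset.mul_sum]
  refine Finset.sum_congr rfl fun α _ => ?_
  rcases α with i | p
  · simp [jet, pd_mul hf hg, h0, h1]
  · simp only [jet, Sum.elim_inr, pd_pd_mul hf hg, h0, h1, smul_eq_mul]; ring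

/-- Without second-order coefficients the Leibniz rule differentiates `f` only in terms that retain
the factor `g y = 0`. -/
theorem diffOp_mul_of_firstOrder {f g : Euc n → ℝ} (hf : ContDiff ℝ ∞ f) (hg : ContDiff ℝ ∞ g)
    {y : Euc n} (h0 : g y = 0) {c : JetIndex n → ℝ} (hc : ∀ p, c (Sum.inr p) = 0) :
    diffOp c (fun z => f z * g z) y = f y * diffOp c g y := by
  rw [diffOp, diffOp, Finset.mul_sum]
  refine Finset.sum_congr rfl fun α _ => ?_
  rcases α with i | p
  · simp only [jet, Sum.elim_inl, pd_mul hf hg, h0, smul_eq_mul]; ring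
  · simp [hc]

theorem pd_eq_zero_of_nonneg {g : Euc n → ℝ} {y : Euc n} (h : ∀ z, 0 ≤ g z) (h0 : g y = 0)
    (i : Fin n) : pd i g y = 0 := by
  have : IsLocalMin g y := Eventually.of_forall fun z => by rw [h0]; exact h z
  simp [pd, this.fderiv_eq_zero]

/-- A function divisible by the square of a nonnegative function `g` has vanishing derivatives of
orders one and two at the zeros of `g`. -/
theorem diffOp_mul_sq_eq_zero {f g : Euc n → ℝ} (hf : ContDiff ℝ ∞ f) (hg : ContDiff ℝ ∞ g)
    {y : Euc n} (h : ∀ z, 0 ≤ g z) (h0 : g y = 0) (c : JetIndex n → ℝ) :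
    diffOp c (fun z => f z * g z ^ 2) y = 0 := by
  have h1 := pd_eq_zero_of_nonneg h h0
  have : (fun z => f z * g z ^ 2) = fun z => (f z * g z) * g z := by funext z; ring
  rw [this, diffOp_mul_of_vanish (hf.mul hg) hg h0 h1, h0, mul_zero, zero_mul]

theorem contDiff_coord (i : Fin n) (a : ℝ) : ContDiff ℝ ∞ (fun z : Euc n => z i - a) := by
  have : ContDiff ℝ ∞ (fun z : Euc n => EuclideanSpace.proj (𝕜 := ℝ) i z - a) := by fun_prop
  exact this

theorem pd_coord (k i : Fin n) (a : ℝ) :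
    pd k (fun z : Euc n => z i - a) = fun _ => if k = i then 1 else 0 := by
  funext y
  have h : HasFDerivAt (fun z : Euc n => z i - a)
      (EuclideanSpace.proj (𝕜 := ℝ) i : Euc n →L[ℝ] ℝ) y :=
    (EuclideanSpace.proj (𝕜 := ℝ) i : Euc n →L[ℝ] ℝ).hasFDerivAt.sub_const a
  simp [pd, h.fderiv, eq_comm]

theorem diffOp_coord (c : JetIndex n → ℝ) (i : Fin n) (a : ℝ) (y : Euc n) :
    diffOp c (fun z : Euc n => z i - a) y = c (Sum.inl i) := by
  simp [diffOp, jet, Fintype.sum_sum_type, pd_coord, pd_const]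

theorem diffOp_coord_mul (c : JetIndex n → ℝ) (p : {p : Fin n × Fin n // p.1 ≤ p.2}) (y : Euc n) :
    diffOp c (fun z : Euc n => (z p.1.1 - y p.1.1) * (z p.1.2 - y p.1.2)) y =
      c (Sum.inr p) * if p.1.1 = p.1.2 then 2 else 1 := by
  obtain ⟨⟨i, j⟩, hij⟩ := p
  have e : ∀ q : {p : Fin n × Fin n // p.1 ≤ p.2},
      (c (Sum.inr q) * ((if q.1.1 = i then 1 else 0) * (if q.1.2 = j then 1 else 0) +
        (if q.1.2 = i then 1 else 0) * (if q.1.1 = j then 1 else 0)) : ℝ) =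
      if q = ⟨(i, j), hij⟩ then c (Sum.inr q) * (if i = j then 2 else 1) else 0 := by
    rintro ⟨⟨k, l⟩, hkl⟩
    simp only [Subtype.mk.injEq, Prod.mk.injEq] at hkl hij ⊢
    by_cases h1 : k = i ∧ l = j
    · obtain ⟨rfl, rfl⟩ := h1
      by_cases h : k = l
      · subst h; norm_num
      · simp [h, Ne.symm h]
    · rw [if_neg h1]
      -- Both pairs are weakly increasing, so the transposed match is possible only on the diagonal.
      by_cases h2 : l = i ∧ k = j
      · obtain ⟨rfl, rfl⟩ := h2
        have : k = l := le_antisymm hkl hij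
        exact absurd ⟨this, this.symm⟩ h1
      · grind
  have hi := contDiff_coord i (y i)
  have hj := contDiff_coord j (y j)
  have j1 : ∀ k, jet (fun z : Euc n => (z i - y i) * (z j - y j)) y (Sum.inl k) = 0 := by
    intro k
    simp [jet, pd_mul hi hj]
  have j2 : ∀ q : {p : Fin n × Fin n // p.1 ≤ p.2},
      jet (fun z : Euc n => (z i - y i) * (z j - y j)) y (Sum.inr q) =
        (if q.1.1 = i then 1 else 0) * (if q.1.2 = j then 1 else 0) +
        (if q.1.2 = i then 1 else 0) * (if q.1.1 = j then 1 else 0) := by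
    intro q
    simp only [jet, Sum.elim_inr, pd_pd_mul hi hj, pd_coord, pd_const]
    ring
  simp only [diffOp, Fintype.sum_sum_type, j1, j2, smul_eq_mul, e, mul_zero,
    Finset.sum_const_zero, zero_add, Finset.sum_ite_eq', Finset.mem_univ,
    if_true]

end Jets

/-! ### Independence of the two-jet and its invariance under changes of coordinates. -/

section Freeness

variable {n : ℕ} {F G : Type*} [NormedAddCommGroup F] [NormedSpace ℝ F]
  [NormedAddCommGroup G] [NormedSpace ℝ G]

/-- Every symmetric two-jet of a real function at `y` is the two-jet of a linear functional of
`f`. -/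
def SpansJets (f : Euc n → F) (y : Euc n) : Prop :=
  ∀ (l : Euc n →L[ℝ] ℝ) (B : Euc n →L[ℝ] Euc n →L[ℝ] ℝ), (∀ v w, B v w = B w v) →
    ∃ μ : F →ₗ[ℝ] ℝ, (∀ v, μ (fderiv ℝ f y v) = l v) ∧
      ∀ v w, μ (fderiv ℝ (fderiv ℝ f) y v w) = B v w

theorem ext_single {v : Euc n → ℝ} {w : Euc n → ℝ} (hv : IsLinearMap ℝ v) (hw : IsLinearMap ℝ w)
    (h : ∀ i, v (EuclideanSpace.single i 1) = w (EuclideanSpace.single i 1)) : v = w := by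
  have : hv.mk' = hw.mk' :=
    (EuclideanSpace.basisFun (Fin n) ℝ).toBasis.ext fun i => by simpa using h i
  funext x
  exact LinearMap.congr_fun this x

theorem pd_pd_eq {f : Euc n → F} {y : Euc n} (hf : ContDiffAt ℝ ∞ f y) (i j : Fin n) :
    pd i (pd j f) y =
      fderiv ℝ (fderiv ℝ f) y (EuclideanSpace.single i 1) (EuclideanSpace.single j 1) := by
  have h : DifferentiableAt ℝ (fderiv ℝ f) y :=
    (hf.fderiv_right (m := ∞) (by simp)).differentiableAt (by simp)
  have h' := h.hasFDerivAt.clm_apply (hasFDerivAt_const (EuclideanSpace.single j (1 : ℝ)) y)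
  change fderiv ℝ (fun z => fderiv ℝ f z (EuclideanSpace.single j (1 : ℝ))) y _ = _
  rw [h'.fderiv]
  simp

theorem SpansJets.of_linearIndependent {f : Euc n → F} {y : Euc n} (hf : ContDiffAt ℝ ∞ f y)
    (h : LinearIndependent ℝ (jet f y)) : SpansJets f y := by
  intro l B hB
  obtain ⟨ν, hν⟩ := LinearMap.exists_leftInverse_of_injective _ (LinearMap.ker_eq_bot.mpr h)
  let t : JetIndex n → ℝ := Sum.elim (fun i => l (EuclideanSpace.single i 1))
    fun p => B (EuclideanSpace.single p.1.1 1) (EuclideanSpace.single p.1.2 1)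
  let μ : F →ₗ[ℝ] ℝ := (Finsupp.linearCombination ℝ t).comp ν
  have hμ : ∀ α, μ (jet f y α) = t α := by
    intro α
    have := LinearMap.congr_fun hν (Finsupp.single α 1)
    simp only [LinearMap.comp_apply, Finsupp.linearCombination_single, one_smul,
      LinearMap.id_apply] at this
    simp [μ, this]
  have hsymm : IsSymmSndFDerivAt ℝ f y := by
    refine hf.isSymmSndFDerivAt ?_
    rw [minSmoothness_of_isRCLikeNormedField]
    exact ENat.LEInfty.out
  have hij : ∀ i j, μ (fderiv ℝ (fderiv ℝ f) y (EuclideanSpace.single i 1)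
      (EuclideanSpace.single j 1)) =
        B (EuclideanSpace.single i 1) (EuclideanSpace.single j 1) := by
    intro i j
    rcases le_total i j with h | h
    · rw [← pd_pd_eq hf]; exact hμ (Sum.inr ⟨(i, j), h⟩)
    · rw [hsymm.eq, hB, ← pd_pd_eq hf]; exact hμ (Sum.inr ⟨(j, i), h⟩)
  refine ⟨μ, fun v => ?_, fun v w => ?_⟩
  · exact congrFun (ext_single (μ.comp (fderiv ℝ f y).toLinearMap).isLinear
      l.toLinearMap.isLinear fun i => hμ (Sum.inl i)) v
  · refine congrFun (ext_single
      (v := fun w => μ (fderiv ℝ (fderiv ℝ f) y v w)) (w := fun w => B v w)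
      (μ.comp (fderiv ℝ (fderiv ℝ f) y v).toLinearMap).isLinear
      (B v).toLinearMap.isLinear fun j => ?_) w
    refine congrFun (ext_single
      (v := fun v => μ (fderiv ℝ (fderiv ℝ f) y v (EuclideanSpace.single j 1)))
      (w := fun v => B v (EuclideanSpace.single j 1))
      ⟨fun a b => ?_, fun a b => ?_⟩ ⟨fun a b => ?_, fun a b => ?_⟩ fun i => hij i j) v
    all_goals simp

/-- Testing a relation against the jets `e i` and `e i ⊗ e j + e j ⊗ e i` isolates each coefficient,
up to a factor 2 on the diagonal. -/
theorem SpansJets.linearIndependent {f : Euc n → F} {y : Euc n} (hf : ContDiffAt ℝ ∞ f y)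
    (h : SpansJets f y) : LinearIndependent ℝ (jet f y) := by
  rw [Fintype.linearIndependent_iff]
  intro c hc α
  let e : Fin n → Euc n →L[ℝ] ℝ := fun i => EuclideanSpace.proj i
  have he : ∀ i j, e i (EuclideanSpace.single j 1) = if i = j then 1 else 0 := by
    intro i j; simp [e]
  have key : ∀ (l : Euc n →L[ℝ] ℝ) (B : Euc n →L[ℝ] Euc n →L[ℝ] ℝ), (∀ v w, B v w = B w v) →
      ∑ i, c (Sum.inl i) * l (EuclideanSpace.single i 1) +
        ∑ p : {p : Fin n × Fin n // p.1 ≤ p.2}, c (Sum.inr p) *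
          B (EuclideanSpace.single p.1.1 1) (EuclideanSpace.single p.1.2 1) = 0 := by
    intro l B hB
    obtain ⟨μ, h1, h2⟩ := h l B hB
    have j1 : ∀ i, μ (jet f y (Sum.inl i)) = l (EuclideanSpace.single i 1) := fun i => h1 _
    have j2 : ∀ p : {p : Fin n × Fin n // p.1 ≤ p.2}, μ (jet f y (Sum.inr p)) =
        B (EuclideanSpace.single p.1.1 1) (EuclideanSpace.single p.1.2 1) := by
      intro p
      rw [← h2, ← pd_pd_eq hf]
      rfl
    have := congrArg μ hc
    simpa only [map_add, map_sum, Fintype.sum_sum_type, map_zero, map_smul, j1, j2, smul_eq_mul] using this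
  rcases α with i | ⟨⟨i, j⟩, hij⟩
  · simpa [he] using key (e i) 0 (by simp)
  · have := key 0 ((e i).smulRight (e j) + (e j).smulRight (e i)) (fun v w => by
      simp only [add_apply, ContinuousLinearMap.smulRight_apply, smul_apply, smul_eq_mul]; ring)
    simp only [zero_apply, mul_zero, Finset.sum_const_zero, zero_add, add_apply,
      ContinuousLinearMap.smulRight_apply, smul_apply, he, smul_eq_mul] at this
    rw [Finset.sum_eq_single ⟨(i, j), hij⟩] at this
    · simp only [if_true, mul_one] at this
      split_ifs at this <;> linarith
    · rintro ⟨⟨k, l⟩, hkl⟩ - hne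
      simp only [ne_eq, Subtype.mk.injEq, Prod.mk.injEq] at hne hkl hij ⊢
      grind
    · exact fun h => absurd (Finset.mem_univ _) h

/-- By the chain rule `D²(f ∘ τ)(v, w) = D²f(Tv, Tw) + Df(D²τ(v, w))`. The prescribed jet can thus
be carried to `τ y`: transport `l` by `T⁻¹`, subtract the `D²τ` correction from `B`, and transport
the difference. Symmetry of `D²τ` keeps the new form symmetric. -/
theorem SpansJets.comp {f : Euc n → F} {τ : Euc n → Euc n} {y : Euc n}
    (hf : ContDiffAt ℝ ∞ f (τ y)) (hτ : ContDiffAt ℝ ∞ τ y) (T : Euc n ≃L[ℝ] Euc n)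
    (hT : fderiv ℝ τ y = T) (h : SpansJets f (τ y)) : SpansJets (f ∘ τ) y := by
  intro l B hB
  have hdf : DifferentiableAt ℝ (fderiv ℝ f) (τ y) :=
    (hf.fderiv_right (m := ∞) (by simp)).differentiableAt (by simp)
  have hdτ : DifferentiableAt ℝ (fderiv ℝ τ) y :=
    (hτ.fderiv_right (m := ∞) (by simp)).differentiableAt (by simp)
  have hτ' := hτ.differentiableAt (by simp)
  have hev : fderiv ℝ (f ∘ τ) =ᶠ[𝓝 y] fun z => (fderiv ℝ f (τ z)).comp (fderiv ℝ τ z) := by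
    have e1 : ∀ᶠ z in 𝓝 y, ContDiffAt ℝ 1 τ z :=
      (hτ.of_le (m := 1) (by exact_mod_cast le_top)).eventually (by simp)
    have e2 : ∀ᶠ z in 𝓝 y, ContDiffAt ℝ 1 f (τ z) :=
      hτ.continuousAt.eventually
        ((hf.of_le (m := 1) (by exact_mod_cast le_top)).eventually (by simp))
    filter_upwards [e1, e2] with z h1 h2
    exact fderiv_comp z (h2.differentiableAt (by simp)) (h1.differentiableAt (by simp))
  have h2 : HasFDerivAt (fun z => (fderiv ℝ f (τ z)).comp (fderiv ℝ τ z)) _ y :=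
    (hdf.hasFDerivAt.comp y hτ'.hasFDerivAt).clm_comp hdτ.hasFDerivAt
  have hsymm : IsSymmSndFDerivAt ℝ τ y := hτ.isSymmSndFDerivAt (by
    rw [minSmoothness_of_isRCLikeNormedField]; exact ENat.LEInfty.out)
  let l' : Euc n →L[ℝ] ℝ := l.comp (T.symm : Euc n →L[ℝ] Euc n)
  let B₀ : Euc n →L[ℝ] Euc n →L[ℝ] ℝ :=
    B - (ContinuousLinearMap.compL ℝ (Euc n) (Euc n) ℝ l').comp (fderiv ℝ (fderiv ℝ τ) y)
  have hB₀ : ∀ v w, B₀ v w = B v w - l' (fderiv ℝ (fderiv ℝ τ) y v w) := fun v w => by simp [B₀]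
  let B' : Euc n →L[ℝ] Euc n →L[ℝ] ℝ :=
    B₀.bilinearComp (T.symm : Euc n →L[ℝ] Euc n) (T.symm : Euc n →L[ℝ] Euc n)
  have hB' : ∀ v w, B' v w = B₀ (T.symm v) (T.symm w) := fun v w => rfl
  obtain ⟨μ, m1, m2⟩ := h l' B' fun v w => by
    rw [hB', hB', hB₀, hB₀, hB, hsymm.eq]
  refine ⟨μ, fun v => ?_, fun v w => ?_⟩
  · rw [hev.eq_of_nhds, ContinuousLinearMap.comp_apply, m1, hT]
    simp [l']
  · rw [hev.fderiv_eq, h2.fderiv]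
    simp [hT, m1, m2, hB', hB₀]

theorem linearIndependent_jet_comp {f : Euc n → F} {τ : Euc n → Euc n} {y : Euc n}
    (hf : ContDiffAt ℝ ∞ f (τ y)) (hτ : ContDiffAt ℝ ∞ τ y) (T : Euc n ≃L[ℝ] Euc n)
    (hT : fderiv ℝ τ y = T) (h : LinearIndependent ℝ (jet f (τ y))) :
    LinearIndependent ℝ (jet (f ∘ τ) y) :=
  ((SpansJets.of_linearIndependent hf h).comp hf hτ T hT).linearIndependent (hf.comp y hτ)

/-- The first derivative of a map with independent two-jet is injective. -/
theorem injective_fderiv_of_linearIndependent_jet {f : Euc n → F} {y : Euc n}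
    (hf : ContDiffAt ℝ ∞ f y) (h : LinearIndependent ℝ (jet f y)) :
    Function.Injective (fderiv ℝ f y) := by
  rw [injective_iff_map_eq_zero]
  intro v hv
  ext i
  obtain ⟨μ, h1, -⟩ := SpansJets.of_linearIndependent hf h (EuclideanSpace.proj i) 0 (by simp)
  have := h1 v
  rw [hv, map_zero] at this
  simpa using this.symm

theorem s_eq_sum (n : ℕ) : s n = ∑ i ∈ Finset.range n, (i + 1) := by
  induction n with
  | zero => rfl
  | succ k ih =>
    rw [Finset.sum_range_succ, ← ih, s, s]
    have : (k + 1) * (k + 1 + 1) = k * (k + 1) + (k + 1) * 2 := by ring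
    rw [this, Nat.add_mul_div_right _ _ two_pos]

theorem card_jetIndex (n : ℕ) : Fintype.card (JetIndex n) = n + s n := by
  rw [Fintype.card_sum, Fintype.card_fin, s_eq_sum, Finset.sum_range]
  congr 1
  let e : {p : Fin n × Fin n // p.1 ≤ p.2} ≃ Σ j : Fin n, Set.Iic j :=
    { toFun := fun p => ⟨p.1.2, p.1.1, p.2⟩
      invFun := fun p => ⟨(p.2.1, p.1), p.2.2⟩
      left_inv := fun p => rfl
      right_inv := fun p => rfl }
  rw [Fintype.card_congr e, Fintype.card_sigma]
  simp

end Freeness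

/-! ### Parametric transversality for affine families, by Hausdorff dimension. -/

section Parametric

variable {P A G : Type*} [NormedAddCommGroup P] [NormedSpace ℝ P]
  [NormedAddCommGroup A] [NormedSpace ℝ A] [FiniteDimensional ℝ A]
  [NormedAddCommGroup G] [NormedSpace ℝ G] [FiniteDimensional ℝ G]

theorem contDiffAt_ring_inverse_comp {T : P → G →L[ℝ] G} (hT : ContDiff ℝ 1 T) {p : P}
    (hp : IsUnit (T p)) : ContDiffAt ℝ 1 (fun p => Ring.inverse (T p)) p := by
  obtain ⟨e, he⟩ := hp
  have h := contDiffAt_ringInverse ℝ (n := 1) e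
  rw [he] at h
  exact h.comp p hT.contDiffAt

variable [FiniteDimensional ℝ P]

/-- With a fixed `R`, the solutions are a `C^1` image of part of `P × C`, where `C` is a complement
of the range of `R`. Its dimension is `dim P + dim A - dim G < dim A`. -/
theorem dimH_zeros_le_of_isUnit (hdim : finrank ℝ P < finrank ℝ G) {T : P → A →L[ℝ] G}
    {b : P → G} (hT : ContDiff ℝ 1 T) (hb : ContDiff ℝ 1 b) (R : G →L[ℝ] A) :
    dimH {a : A | ∃ p, IsUnit ((T p).comp R) ∧ T p a + b p = 0} ≤ (finrank ℝ A - 1 : ℕ) := by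
  by_cases hne : ∃ p, IsUnit ((T p).comp R)
  swap
  · have : {a : A | ∃ p, IsUnit ((T p).comp R) ∧ T p a + b p = 0} = ∅ := by
      ext a
      simp only [mem_ofPred_eq, mem_empty_iff_false, iff_false]
      exact fun ⟨p, h, _⟩ => hne ⟨p, h⟩
    rw [this, dimH_empty]
    exact zero_le
  obtain ⟨p₀, hp₀⟩ := hne
  have hRinj : Function.Injective R := by
    obtain ⟨e, he⟩ := hp₀
    intro v w hvw
    have h2 : (e : G →L[ℝ] G) v = (e : G →L[ℝ] G) w := by
      rw [he]; simp [hvw]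
    have h3 := congrArg (↑e⁻¹ : G →L[ℝ] G) h2
    rwa [← mul_apply_eq_comp, ← mul_apply_eq_comp, Units.inv_mul] at h3
  obtain ⟨C, hC⟩ := Submodule.exists_isCompl (LinearMap.range R.toLinearMap)
  have hrank : finrank ℝ G + finrank ℝ C = finrank ℝ A := by
    rw [← Submodule.finrank_add_eq_of_isCompl hC, LinearMap.finrank_range_of_inj hRinj]
  -- Write `a = R v + c` with `c ∈ C`: invertibility of `T p ∘ R` determines `v` from `(p, c)`.
  let Φ : P × C → A := fun x =>
    x.2 - R (Ring.inverse ((T x.1).comp R) (T x.1 x.2 + b x.1))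
  let U : Set (P × C) := {x | IsUnit ((T x.1).comp R)}
  have hTR : ContDiff ℝ 1 fun p => (T p).comp R := hT.clm_comp contDiff_const
  have hΦ : ∀ x ∈ U, ContDiffAt ℝ 1 Φ x := by
    intro x hx
    have h1 : ContDiffAt ℝ 1 (fun x : P × C => Ring.inverse ((T x.1).comp R)) x :=
      (contDiffAt_ring_inverse_comp hTR hx).comp x contDiffAt_fst
    have h0 : ContDiff ℝ 1 (fun x : P × C => (x.2 : A)) := C.subtypeL.contDiff.comp contDiff_snd
    have h2 : ContDiffAt ℝ 1 (fun x : P × C => T x.1 x.2 + b x.1) x :=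
      (((hT.comp contDiff_fst).clm_apply h0).add (hb.comp contDiff_fst)).contDiffAt
    exact h0.contDiffAt.sub (R.contDiff.contDiffAt.comp x (h1.clm_apply h2))
  have hsub : {a : A | ∃ p, IsUnit ((T p).comp R) ∧ T p a + b p = 0} ⊆ Φ '' U := by
    rintro a ⟨p, hp, ha⟩
    obtain ⟨r, hr, c, hc, rfl⟩ := Submodule.mem_sup.1
      (hC.sup_eq_top ▸ Submodule.mem_top : a ∈ LinearMap.range R.toLinearMap ⊔ C)
    obtain ⟨v, rfl⟩ := hr
    refine ⟨(p, ⟨c, hc⟩), hp, ?_⟩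
    have h1 : T p c + b p = - ((T p).comp R) v := by
      simp only [ContinuousLinearMap.coe_coe, map_add] at ha
      rw [ContinuousLinearMap.comp_apply, eq_neg_iff_add_eq_zero, ← ha]
      abel
    have h2 : Ring.inverse ((T p).comp R) (((T p).comp R) v) = v := by
      rw [← mul_apply_eq_comp, Ring.inverse_mul_cancel _ hp]
      rfl
    change c - R (Ring.inverse ((T p).comp R) (T p c + b p)) = _
    rw [h1, map_neg, h2, map_neg, sub_neg_eq_add, add_comm]
    rfl
  calc dimH _ ≤ dimH (Φ '' U) := dimH_mono hsub
    _ ≤ dimH U := by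
        refine dimH_image_le_of_locally_lipschitzOn fun x hx => ?_
        obtain ⟨K, t, ht, hK⟩ := (hΦ x hx).exists_lipschitzOnWith
        exact ⟨K, t, mem_nhdsWithin_of_mem_nhds ht, hK⟩
    _ ≤ dimH (univ : Set (P × C)) := dimH_mono (subset_univ _)
    _ = (finrank ℝ (P × C) : ℕ) := Real.dimH_univ_eq_finrank _
    _ ≤ (finrank ℝ A - 1 : ℕ) := by
        rw [finrank_prod]
        exact_mod_cast (by omega)

/-- The parameters `a` for which an equation affine in `a`, with fewer unknowns than equations,
has a solution at which the linear part is onto form a set of positive codimension. -/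
theorem dimH_zeros_le (hdim : finrank ℝ P < finrank ℝ G) {T : P → A →L[ℝ] G}
    {b : P → G} (hT : ContDiff ℝ 1 T) (hb : ContDiff ℝ 1 b) :
    dimH {a : A | ∃ p, Function.Surjective (T p) ∧ T p a + b p = 0} ≤
      (finrank ℝ A - 1 : ℕ) := by
  have hR : ∀ p : P, ∃ R : G →L[ℝ] A, Function.Surjective (T p) → IsUnit ((T p).comp R) := by
    intro p
    by_cases hp : Function.Surjective (T p)
    · obtain ⟨R, hR⟩ := LinearMap.exists_rightInverse_of_surjective (T p).toLinearMap
        (LinearMap.range_eq_top.2 hp)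
      refine ⟨LinearMap.toContinuousLinearMap R, fun _ => ?_⟩
      have : (T p).comp (LinearMap.toContinuousLinearMap R) = 1 := by
        ext v
        exact LinearMap.congr_fun hR v
      rw [this]
      exact isUnit_one
    · exact ⟨0, fun h => absurd h hp⟩
  choose R hR using hR
  -- A right inverse at `p₀` still makes `T p ∘ R p₀` invertible for `p` near `p₀`, so countably
  -- many choices of `R` suffice.
  obtain ⟨t, -, htc, ht⟩ := TopologicalSpace.countable_cover_nhdsWithin
    (s := {p | Function.Surjective (T p)})
    (f := fun p₀ => {p | IsUnit ((T p).comp (R p₀))}) fun p₀ hp₀ =>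
      mem_nhdsWithin_of_mem_nhds <| by
        have hc : Continuous fun p => (T p).comp (R p₀) :=
          (hT.clm_comp contDiff_const).continuous
        exact hc.continuousAt.preimage_mem_nhds (Units.isOpen.mem_nhds (hR p₀ hp₀))
  have hsub : {a : A | ∃ p, Function.Surjective (T p) ∧ T p a + b p = 0} ⊆
      ⋃ p₀ ∈ t, {a : A | ∃ p, IsUnit ((T p).comp (R p₀)) ∧ T p a + b p = 0} := by
    rintro a ⟨p, hp, ha⟩
    obtain ⟨p₀, hp₀, h⟩ := mem_iUnion₂.1 (ht hp)
    exact mem_iUnion₂.2 ⟨p₀, hp₀, p, h, ha⟩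
  refine (dimH_mono hsub).trans ?_
  rw [dimH_bUnion htc]
  exact iSup₂_le fun p₀ _ => dimH_zeros_le_of_isUnit hdim hT hb (R p₀)

end Parametric

/-! ### Polynomial functions of bounded degree. -/

section Polynomials

variable {n : ℕ}

variable (n) in
/-- The polynomial functions of degree at most one. -/
def affineFunctions : Submodule ℝ (Euc n → ℝ) :=
  Submodule.span ℝ (insert 1 (range fun i (z : Euc n) => z i))

theorem one_mem_affineFunctions : (1 : Euc n → ℝ) ∈ affineFunctions n :=
  Submodule.subset_span (mem_insert _ _)

theorem const_mem_affineFunctions (a : ℝ) : (fun _ : Euc n => a) ∈ affineFunctions n := by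
  have := (affineFunctions n).smul_mem a one_mem_affineFunctions
  convert this using 1
  funext z; simp

theorem coord_sub_mem_affineFunctions (i : Fin n) (a : ℝ) :
    (fun z : Euc n => z i - a) ∈ affineFunctions n :=
  (affineFunctions n).sub_mem (Submodule.subset_span (mem_insert_of_mem _ ⟨i, rfl⟩))
    (const_mem_affineFunctions a)

theorem contDiff_of_mem_affineFunctions {f : Euc n → ℝ} (hf : f ∈ affineFunctions n) :
    ContDiff ℝ ∞ f := by
  induction hf using Submodule.span_induction with
  | mem f hf =>
    rcases hf with rfl | ⟨i, rfl⟩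
    · exact contDiff_const
    · simpa using contDiff_coord i 0
  | zero => exact contDiff_const
  | add f g _ _ hf hg => exact hf.add hg
  | smul a f _ hf => exact contDiff_const.mul hf

theorem contDiff_of_mem_affineFunctions_pow {D : ℕ} {f : Euc n → ℝ}
    (hf : f ∈ affineFunctions n ^ D) : ContDiff ℝ ∞ f := by
  induction D generalizing f with
  | zero =>
    rw [pow_zero, Submodule.mem_one] at hf
    obtain ⟨a, rfl⟩ := hf
    exact contDiff_const
  | succ D ih =>
    rw [pow_succ] at hf
    induction hf using Submodule.mul_induction_on' with
    | mem_mul_mem f hf g hg => exact (ih hf).mul (contDiff_of_mem_affineFunctions hg)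
    | add f _ g _ hf hg => exact hf.add hg

theorem fg_affineFunctions_pow (n D : ℕ) : (affineFunctions n ^ D).FG :=
  Submodule.FG.pow (Submodule.fg_span ((finite_range _).insert _)) D

theorem mem_affineFunctions_pow_of_le {D D' : ℕ} (h : D ≤ D') {f : Euc n → ℝ}
    (hf : f ∈ affineFunctions n ^ D) : f ∈ affineFunctions n ^ D' :=
  pow_le_pow_right' (Submodule.one_le.2 one_mem_affineFunctions) h hf

theorem exists_family_affineFunctions_pow (n D : ℕ) :
    ∃ (m : ℕ) (h : Fin m → Euc n → ℝ), (∀ i, ContDiff ℝ ∞ (h i)) ∧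
      ∀ f ∈ affineFunctions n ^ D, ∃ β : Fin m → ℝ, ∀ z, f z = ∑ i, β i * h i z := by
  obtain ⟨m, h, hh⟩ := Submodule.fg_iff_exists_fin_generating_family.1 (fg_affineFunctions_pow n D)
  refine ⟨m, h, fun i => contDiff_of_mem_affineFunctions_pow (D := D)
    (hh ▸ Submodule.subset_span ⟨i, rfl⟩), fun f hf => ?_⟩
  rw [← hh, Submodule.mem_span_range_iff_exists_fun] at hf
  obtain ⟨β, rfl⟩ := hf
  exact ⟨β, fun z => by simp⟩

theorem normSq_mem_affineFunctions_sq (w : Euc n) :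
    (fun z : Euc n => ‖z - w‖ ^ 2) ∈ affineFunctions n ^ 2 := by
  have : (fun z : Euc n => ‖z - w‖ ^ 2) =
      ∑ i, (fun z : Euc n => z i - w i) * (fun z : Euc n => z i - w i) := by
    funext z
    simp [EuclideanSpace.norm_sq_eq, Finset.sum_apply, ← pow_two]
  rw [this, pow_two]
  exact Submodule.sum_mem _ fun i _ => Submodule.mul_mem_mul
    (coord_sub_mem_affineFunctions i _) (coord_sub_mem_affineFunctions i _)

/-- Each factor is a quartic whose whole two-jet vanishes at its centre: every point at which the
jet is to be killed costs four degrees. -/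
theorem prod_normSq_mem {ι : Type*} (W : Finset ι) (w : ι → Euc n) :
    (fun z : Euc n => ∏ i ∈ W, (‖z - w i‖ ^ 2) ^ 2) ∈ affineFunctions n ^ (4 * W.card) := by
  classical
  induction W using Finset.induction_on with
  | empty =>
    rw [Finset.card_empty, mul_zero, pow_zero]
    simp only [Finset.prod_empty]
    exact Submodule.one_le.1 le_rfl
  | insert i W hi ih =>
    rw [Finset.card_insert_of_notMem hi, mul_add, mul_one, add_comm, pow_add]
    simp only [Finset.prod_insert hi]
    refine Submodule.mul_mem_mul (m := fun z : Euc n => (‖z - w i‖ ^ 2) ^ 2) ?_ ih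
    have : affineFunctions n ^ 4 = affineFunctions n ^ 2 * affineFunctions n ^ 2 := by
      rw [← pow_add]
    rw [this]
    have h := Submodule.mul_mem_mul (normSq_mem_affineFunctions_sq (w i))
      (normSq_mem_affineFunctions_sq (w i))
    convert h using 1
    funext z; simp [sq]

theorem contDiff_normSq_sub (w : Euc n) : ContDiff ℝ ∞ (fun z : Euc n => ‖z - w‖ ^ 2) :=
  (contDiff_id.sub contDiff_const).norm_sq ℝ

end Polynomials

/-! ### Averages over the group weighted by a cutoff. -/

section Average

variable {n : ℕ} {Γ : Type*} [Group Γ] [MulAction Γ (Euc n)]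
  {F G : Type*} [NormedAddCommGroup F] [NormedSpace ℝ F]
  [NormedAddCommGroup G] [NormedSpace ℝ G]

/-- The sum of the maps `T γ` weighted by the translates of `χ`. -/
def average (χ : Euc n → ℝ) (T : Γ → Euc n → F) (x : Euc n) : F :=
  ∑ᶠ γ : Γ, χ (γ⁻¹ • x) • T γ x

variable {χ : Euc n → ℝ}

theorem average_eq_sum {t : Finset Γ} {x : Euc n} (ht : ∀ γ : Γ, χ (γ⁻¹ • x) ≠ 0 → γ ∈ t)
    (T : Γ → Euc n → F) : average χ T x = ∑ γ ∈ t, χ (γ⁻¹ • x) • T γ x := by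
  refine finsum_eq_sum_of_support_subset _ fun γ hγ => ht γ fun h => hγ ?_
  simp [h]

theorem average_smul (T : Γ → Euc n → F) (δ : Γ) (x : Euc n) :
    average χ T (δ • x) = average χ (fun γ y => T (δ * γ) (δ • y)) x := by
  rw [average, ← finsum_comp_equiv (Equiv.mulLeft δ)]
  refine finsum_congr fun γ => ?_
  simp [mul_smul]

variable [ProperlyDiscontinuousSMul Γ (Euc n)]

variable (Γ) in
theorem exists_finset_average_eq (hχ : HasCompactSupport χ) (x : Euc n) :
    ∃ t : Finset Γ, ∀ᶠ y in 𝓝 x, ∀ γ : Γ, χ (γ⁻¹ • y) ≠ 0 → γ ∈ t := by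
  have hfin := ProperlyDiscontinuousSMul.finite_disjoint_inter_image (Γ := Γ) (T := Euc n)
    hχ.isCompact (isCompact_closedBall x 1)
  refine ⟨hfin.toFinset, ?_⟩
  filter_upwards [Metric.closedBall_mem_nhds x one_pos] with y hy γ hγ
  rw [Finite.mem_toFinset]
  exact ⟨y, ⟨γ⁻¹ • y, subset_tsupport _ hγ, smul_inv_smul γ y⟩, hy⟩

theorem contDiff_average (hχ : HasCompactSupport χ) (hχs : ContDiff ℝ ∞ χ)
    (hsm : ∀ γ : Γ, ContDiff ℝ ∞ (fun x : Euc n => γ • x)) {T : Γ → Euc n → F}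
    (hT : ∀ γ, ContDiff ℝ ∞ (T γ)) : ContDiff ℝ ∞ (average χ T) := by
  rw [contDiff_iff_contDiffAt]
  intro x
  obtain ⟨t, ht⟩ := exists_finset_average_eq Γ hχ x
  have : ContDiff ℝ ∞ fun y => ∑ γ ∈ t, χ (γ⁻¹ • y) • T γ y :=
    ContDiff.sum fun γ _ => (hχs.comp (hsm γ⁻¹)).smul (hT γ)
  refine this.contDiffAt.congr_of_eventuallyEq ?_
  filter_upwards [ht] with y hy using average_eq_sum hy T

theorem map_average (hχ : HasCompactSupport χ) (L : F →L[ℝ] G) (T : Γ → Euc n → F) (x : Euc n) :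
    L (average χ T x) = average χ (fun γ y => L (T γ y)) x := by
  obtain ⟨t, ht⟩ := exists_finset_average_eq Γ hχ x
  rw [average_eq_sum ht.self_of_nhds, average_eq_sum ht.self_of_nhds]
  simp

theorem average_add (hχ : HasCompactSupport χ) (T T' : Γ → Euc n → F) (x : Euc n) :
    average χ (fun γ y => T γ y + T' γ y) x = average χ T x + average χ T' x := by
  obtain ⟨t, ht⟩ := exists_finset_average_eq Γ hχ x
  simp [average_eq_sum ht.self_of_nhds, Finset.sum_add_distrib]

theorem average_const (hχ : HasCompactSupport χ)
    (h1 : ∀ x : Euc n, average χ (fun (_ : Γ) _ => (1 : ℝ)) x = 1) (v : F) (x : Euc n) :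
    average χ (fun (_ : Γ) _ => v) x = v := by
  have := map_average hχ ((ContinuousLinearMap.id ℝ ℝ).smulRight v) (fun (_ : Γ) _ => (1 : ℝ)) x
  simpa [h1] using this.symm

variable (Γ) in
/-- A compactly supported smooth function whose translates sum to one. -/
theorem exists_average_eq_one (hsm : ∀ γ : Γ, ContDiff ℝ ∞ (fun x : Euc n => γ • x))
    (hcc : ∃ K : Set (Euc n), IsCompact K ∧ ∀ x, ∃ γ : Γ, γ • x ∈ K) :
    ∃ χ : Euc n → ℝ, ContDiff ℝ ∞ χ ∧ HasCompactSupport χ ∧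
      ∀ x : Euc n, average χ (fun (_ : Γ) _ => (1 : ℝ)) x = 1 := by
  obtain ⟨K, hK, hKcov⟩ := hcc
  obtain ⟨r, hr⟩ := hK.isBounded.subset_closedBall (0 : Euc n)
  let f : ContDiffBump (0 : Euc n) := ⟨max r 1, max r 1 + 1, by positivity, by linarith⟩
  let S : Euc n → ℝ := average f (fun (_ : Γ) _ => (1 : ℝ))
  have hfs : ContDiff ℝ ∞ (f : Euc n → ℝ) := f.contDiff
  have hS : ContDiff ℝ ∞ S :=
    contDiff_average f.hasCompactSupport hfs hsm fun _ => contDiff_const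
  have hSpos : ∀ x, 0 < S x := by
    intro x
    obtain ⟨t, ht⟩ := exists_finset_average_eq Γ f.hasCompactSupport x
    obtain ⟨γ, hγ⟩ := hKcov x
    have h1 : f (γ⁻¹⁻¹ • x) = 1 := by
      rw [inv_inv]
      exact f.one_of_mem_closedBall
        (Metric.closedBall_subset_closedBall (le_max_left r 1) (hr hγ))
    -- The sum of translates of the bump is positive because some translate of `x` lies in `K`;
    -- being invariant, it can be divided out.
    change 0 < average f _ x
    rw [average_eq_sum ht.self_of_nhds]
    refine Finset.sum_pos' (fun δ _ => by simpa using f.nonneg) ⟨γ⁻¹, ?_, ?_⟩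
    · exact ht.self_of_nhds _ (by rw [h1]; exact one_ne_zero)
    · rw [h1]; simp
  have hSinv : ∀ (γ : Γ) x, S (γ • x) = S x := fun γ x => average_smul _ γ x
  refine ⟨fun x => (S x)⁻¹ * f x, (hS.inv fun x => (hSpos x).ne').mul hfs,
    f.hasCompactSupport.mul_left, fun x => ?_⟩
  have h := map_average f.hasCompactSupport (ContinuousLinearMap.mul ℝ ℝ (S x)⁻¹)
    (fun (_ : Γ) _ => (1 : ℝ)) x
  rw [ContinuousLinearMap.mul_apply', inv_mul_cancel₀ (hSpos x).ne'] at h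
  refine (finsum_congr fun γ => ?_).trans h.symm
  simp [hSinv, mul_comm]

end Average

/-! ### The affine family of equivariant maps. -/

section Family

variable {n q m : ℕ} {Γ : Type*} [Group Γ] [MulAction Γ (Euc n)]

/-- The linear part of an isometric action. -/
def linPart (ρ : Γ →* (Euc q ≃ᵃⁱ[ℝ] Euc q)) (γ : Γ) : Euc q →L[ℝ] Euc q :=
  ((ρ γ).linearIsometryEquiv.toContinuousLinearEquiv : Euc q →L[ℝ] Euc q)

variable (ρ : Γ →* (Euc q ≃ᵃⁱ[ℝ] Euc q))

theorem action_apply (γ : Γ) (z : Euc q) : ρ γ z = linPart ρ γ z + ρ γ 0 := by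
  have := (ρ γ).map_vadd 0 z
  simpa [linPart] using this

theorem action_sub (γ : Γ) (z w : Euc q) : ρ γ z - ρ γ w = linPart ρ γ (z - w) := by
  rw [action_apply ρ γ z, action_apply ρ γ w, map_sub]; abel

theorem linPart_one (v : Euc q) : linPart ρ 1 v = v := by
  simpa using (action_sub ρ 1 v 0).symm

/-- Evaluation at `z` of the linear combinations of the functions `h i`. -/
def evalFamily (q : ℕ) (h : Fin m → Euc n → ℝ) (z : Euc n) : (Fin m → Euc q) →L[ℝ] Euc q :=
  ∑ i, h i z • ContinuousLinearMap.proj i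

theorem contDiff_evalFamily {h : Fin m → Euc n → ℝ} (hh : ∀ i, ContDiff ℝ ∞ (h i)) :
    ContDiff ℝ ∞ (evalFamily q h) :=
  ContDiff.sum fun i _ => (hh i).smul contDiff_const

theorem evalFamily_smul (h : Fin m → Euc n → ℝ) (β : Fin m → ℝ) (v : Euc q) (z : Euc n) :
    evalFamily q h z (fun i => β i • v) = (∑ i, β i * h i z) • v := by
  simp [evalFamily, Finset.sum_smul, smul_smul, mul_comm]

/-- The linear part of the family of equivariant maps. -/
def linFamily (χ : Euc n → ℝ) (h : Fin m → Euc n → ℝ) (x : Euc n) :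
    (Fin m → Euc q) →L[ℝ] Euc q :=
  average χ (fun γ y => (linPart ρ γ).comp (evalFamily q h (γ⁻¹ • y))) x

/-- The constant part of the family of equivariant maps. -/
def constFamily (χ : Euc n → ℝ) (x : Euc n) : Euc q := average χ (fun γ _ => ρ γ 0) x

/-- A family of equivariant maps, affine in the parameter `a`. -/
def family (χ : Euc n → ℝ) (h : Fin m → Euc n → ℝ) (a : Fin m → Euc q) (x : Euc n) : Euc q :=
  linFamily ρ χ h x a + constFamily ρ χ x

variable [ProperlyDiscontinuousSMul Γ (Euc n)] {χ : Euc n → ℝ} {h : Fin m → Euc n → ℝ}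

theorem family_eq_average (hχ : HasCompactSupport χ) (a : Fin m → Euc q) (x : Euc n) :
    family ρ χ h a x = average χ (fun γ y => ρ γ (evalFamily q h (γ⁻¹ • y) a)) x := by
  have h1 := map_average hχ (ContinuousLinearMap.apply ℝ (Euc q) a)
    (fun γ y => (linPart ρ γ).comp (evalFamily q h (γ⁻¹ • y))) x
  change linFamily ρ χ h x a = _ at h1
  rw [family, h1, constFamily, ← average_add hχ]
  congr 1
  funext γ y
  rw [action_apply ρ γ (evalFamily q h (γ⁻¹ • y) a)]
  rfl

/-- Reindexing the sum by `γ` pulls `ρ γ` out of every term. Its translation part then has to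
survive averaging, which is where the total weight 1 enters. -/
theorem family_smul (hχ : HasCompactSupport χ)
    (h1 : ∀ x : Euc n, average χ (fun (_ : Γ) _ => (1 : ℝ)) x = 1)
    (a : Fin m → Euc q) (γ : Γ) (x : Euc n) :
    family ρ χ h a (γ • x) = ρ γ (family ρ χ h a x) := by
  rw [family_eq_average ρ hχ, family_eq_average ρ hχ, average_smul, action_apply,
    map_average hχ]
  have h2 := average_const hχ h1 (ρ γ 0) x
  conv_rhs => rw [← h2]
  rw [← average_add hχ]
  congr 1
  funext δ y
  rw [← action_apply, map_mul, mul_inv_rev, mul_smul, inv_smul_smul]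
  rfl

theorem contDiff_linFamily (hχ : HasCompactSupport χ) (hχs : ContDiff ℝ ∞ χ)
    (hsm : ∀ γ : Γ, ContDiff ℝ ∞ (fun x : Euc n => γ • x)) (hh : ∀ i, ContDiff ℝ ∞ (h i)) :
    ContDiff ℝ ∞ (linFamily ρ χ h) :=
  contDiff_average hχ hχs hsm fun γ =>
    contDiff_const.clm_comp ((contDiff_evalFamily hh).comp (hsm γ⁻¹))

theorem contDiff_constFamily (hχ : HasCompactSupport χ) (hχs : ContDiff ℝ ∞ χ)
    (hsm : ∀ γ : Γ, ContDiff ℝ ∞ (fun x : Euc n => γ • x)) :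
    ContDiff ℝ ∞ (constFamily ρ χ) :=
  contDiff_average hχ hχs hsm fun _ => contDiff_const

/-- The value of the family at a parameter of the form `f v` with `f` a real function. -/
theorem linFamily_smul (hχ : HasCompactSupport χ) {f : Euc n → ℝ} {β : Fin m → ℝ}
    (hf : ∀ z, f z = ∑ i, β i * h i z) (v : Euc q) (x : Euc n) :
    linFamily ρ χ h x (fun i => β i • v) =
      average χ (fun γ y => f (γ⁻¹ • y) • linPart ρ γ v) x := by
  have h1 := map_average hχ (ContinuousLinearMap.apply ℝ (Euc q) (fun i => β i • v))
    (fun γ y => (linPart ρ γ).comp (evalFamily q h (γ⁻¹ • y))) x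
  refine h1.trans ?_
  congr 1
  funext γ y
  change linPart ρ γ (evalFamily q h (γ⁻¹ • y) (fun i => β i • v)) = _
  rw [evalFamily_smul, ← hf, map_smul]

end Family

/-! ### Surjectivity in the parameter, by interpolation. -/

section Surjectivity

variable {n q m : ℕ}

/-- For a nonzero differential operator of order two there is a quadratic polynomial `p` such that
the operator does not vanish on `f p` as soon as `f` does not vanish. -/
theorem exists_diffOp_mul_ne_zero {c : JetIndex n → ℝ} (hc : c ≠ 0) (x : Euc n) :
    ∃ p ∈ affineFunctions n ^ 2, ∀ f : Euc n → ℝ, ContDiff ℝ ∞ f → f x ≠ 0 →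
      diffOp c (fun z => f z * p z) x ≠ 0 := by
  by_cases h2 : ∃ p, c (Sum.inr p) ≠ 0
  · obtain ⟨p, hp⟩ := h2
    have h1 := contDiff_coord p.1.1 (x p.1.1)
    have h2 := contDiff_coord p.1.2 (x p.1.2)
    -- This product vanishes to first order at `x`, so the operator sees only its second
    -- derivatives.
    refine ⟨fun z => (z p.1.1 - x p.1.1) * (z p.1.2 - x p.1.2), ?_, fun f hf hfx => ?_⟩
    · rw [pow_two]
      exact Submodule.mul_mem_mul (coord_sub_mem_affineFunctions p.1.1 _)
        (coord_sub_mem_affineFunctions p.1.2 _)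
    · rw [diffOp_mul_of_vanish hf (h1.mul h2) (by simp) (fun i => by simp [pd_mul h1 h2]),
        diffOp_coord_mul]
      refine mul_ne_zero hfx (mul_ne_zero hp ?_)
      split_ifs <;> norm_num
  · push Not at h2
    obtain ⟨α, hα⟩ := Function.ne_iff.1 hc
    rcases α with i | p
    · refine ⟨fun z => z i - x i, mem_affineFunctions_pow_of_le (D := 1) (by norm_num) ?_,
        fun f hf hfx => ?_⟩
      · rw [pow_one]; exact coord_sub_mem_affineFunctions i _
      · rw [diffOp_mul_of_firstOrder hf (contDiff_coord i _) (by simp) h2, diffOp_coord]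
        exact mul_ne_zero hfx hα
    · exact absurd (h2 p) hα

variable {Γ : Type*} [Group Γ] [MulAction Γ (Euc n)] (ρ : Γ →* (Euc q ≃ᵃⁱ[ℝ] Euc q))
  [ProperlyDiscontinuousSMul Γ (Euc n)] {χ : Euc n → ℝ} {h : Fin m → Euc n → ℝ}

/-- Choose a polynomial whose two-jet vanishes at every other point of the orbit of `x` lying in the
support of `χ`. Only the term `γ = 1` of the average contributes; there the linear part is the
identity, and a quadratic factor makes the scalar nonzero. The set `T` bounds the number of points,
hence the degree, uniformly in `x`. -/
theorem surjective_diffOp_linFamily (hχ : HasCompactSupport χ) (hχs : ContDiff ℝ ∞ χ)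
    (hsm : ∀ γ : Γ, ContDiff ℝ ∞ (fun x : Euc n => γ • x)) (hh : ∀ i, ContDiff ℝ ∞ (h i))
    (hfree : ∀ γ : Γ, γ ≠ 1 → ∀ x : Euc n, γ • x ≠ x) {T : Finset Γ}
    (hT : ∀ (γ : Γ) (x : Euc n), x ∈ tsupport χ → γ • x ∈ tsupport χ → γ ∈ T)
    (hspan : ∀ f ∈ affineFunctions n ^ (2 + 4 * (2 * T.card)),
      ∃ β : Fin m → ℝ, ∀ z, f z = ∑ i, β i * h i z)
    {x : Euc n} (hx : χ x ≠ 0) {c : JetIndex n → ℝ} (hc : c ≠ 0) :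
    Function.Surjective
      (diffOp (F := (Fin m → Euc q) →L[ℝ] Euc q) c (linFamily ρ χ h) x) := by
  classical
  obtain ⟨p, hp, hpne⟩ := exists_diffOp_mul_ne_zero hc x
  have hps := contDiff_of_mem_affineFunctions_pow hp
  have hprod : ∀ W : Finset Γ, ContDiff ℝ ∞ fun z : Euc n => ∏ δ ∈ W, (‖z - δ • x‖ ^ 2) ^ 2 :=
    fun W => contDiff_prod fun δ _ => (contDiff_normSq_sub _).pow 2
  let f : Euc n → ℝ := fun z => p z * ∏ δ ∈ T.erase 1, (‖z - δ • x‖ ^ 2) ^ 2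
  have hfs : ContDiff ℝ ∞ f := hps.mul (hprod _)
  have hf : f ∈ affineFunctions n ^ (2 + 4 * (2 * T.card)) := by
    refine mem_affineFunctions_pow_of_le (D := 2 + 4 * (T.erase 1).card) ?_ ?_
    · have := Finset.card_erase_le (a := (1 : Γ)) (s := T)
      omega
    · rw [pow_add]
      exact Submodule.mul_mem_mul hp (prod_normSq_mem _ _)
  obtain ⟨β, hβ⟩ := hspan f hf
  have hterm : ∀ γ : Γ, ContDiff ℝ ∞ fun y : Euc n => χ (γ⁻¹ • y) * f (γ⁻¹ • y) :=
    fun γ => (hχs.mul hfs).comp (hsm γ⁻¹)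
  obtain ⟨t₀, ht₀⟩ := exists_finset_average_eq Γ hχ x
  let t := insert 1 t₀
  have ht : ∀ᶠ y in 𝓝 x, ∀ γ : Γ, χ (γ⁻¹ • y) ≠ 0 → γ ∈ t := by
    filter_upwards [ht₀] with y hy γ hγ using Finset.mem_insert_of_mem (hy γ hγ)
  have hvan : ∀ γ : Γ, γ ≠ 1 → diffOp c (fun y : Euc n => χ (γ⁻¹ • y) * f (γ⁻¹ • y)) x = 0 := by
    intro γ hγ
    by_cases hsupp : γ⁻¹ • x ∈ tsupport χ
    · have hmem : γ⁻¹ ∈ T.erase 1 :=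
        Finset.mem_erase.2 ⟨inv_ne_one.2 hγ, hT _ x (subset_tsupport _ hx) hsupp⟩
      have heq : (fun y : Euc n => χ (γ⁻¹ • y) * f (γ⁻¹ • y)) = fun y =>
          (χ (γ⁻¹ • y) * (p (γ⁻¹ • y) *
            ∏ δ ∈ (T.erase 1).erase γ⁻¹, (‖γ⁻¹ • y - δ • x‖ ^ 2) ^ 2)) *
              (‖γ⁻¹ • y - γ⁻¹ • x‖ ^ 2) ^ 2 := by
        funext y
        simp only [f]
        rw [← Finset.mul_prod_erase _ _ hmem]
        ring
      rw [heq]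
      refine diffOp_mul_sq_eq_zero ?_ ((contDiff_normSq_sub _).comp (hsm γ⁻¹))
        (fun z => sq_nonneg _) (by simp) c
      exact (hχs.mul (hps.mul (hprod _))).comp (hsm γ⁻¹)
    · have hev : (fun y : Euc n => χ (γ⁻¹ • y) * f (γ⁻¹ • y)) =ᶠ[𝓝 x] fun _ => 0 := by
        have h0 : ∀ᶠ z in 𝓝 (γ⁻¹ • x), χ z = 0 := notMem_tsupport_iff_eventuallyEq.1 hsupp
        filter_upwards [(hsm γ⁻¹).continuous.continuousAt.eventually h0] with y hy
        rw [hy, zero_mul]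
      rw [diffOp_congr hev, diffOp_const]
  have hone : diffOp c (fun y : Euc n => χ ((1 : Γ)⁻¹ • y) * f ((1 : Γ)⁻¹ • y)) x ≠ 0 := by
    have := hpne (fun z => χ z * ∏ δ ∈ T.erase 1, (‖z - δ • x‖ ^ 2) ^ 2) (hχs.mul (hprod _))
      (mul_ne_zero hx (Finset.prod_ne_zero_iff.2 fun δ hδ => by
        have : x - δ • x ≠ 0 := sub_ne_zero.2 (hfree δ (Finset.ne_of_mem_erase hδ) x).symm
        positivity))
    convert this using 2
    funext y
    simp only [inv_one, one_smul, f]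
    ring
  intro v
  let d := diffOp c (fun y : Euc n => χ ((1 : Γ)⁻¹ • y) * f ((1 : Γ)⁻¹ • y)) x
  refine ⟨fun i => β i • d⁻¹ • v, ?_⟩
  have h1 := diffOp_clm_comp
    (ContinuousLinearMap.apply ℝ (Euc q) (fun i => β i • d⁻¹ • v))
    (contDiff_linFamily ρ hχ hχs hsm hh) x c
  refine h1.symm.trans ?_
  have h2 : (fun y => ContinuousLinearMap.apply ℝ (Euc q) (fun i => β i • d⁻¹ • v)
      (linFamily ρ χ h y)) =ᶠ[𝓝 x] fun y => ∑ γ ∈ t,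
        (ContinuousLinearMap.id ℝ ℝ).smulRight (linPart ρ γ (d⁻¹ • v))
          (χ (γ⁻¹ • y) * f (γ⁻¹ • y)) := by
    filter_upwards [ht] with y hy
    refine (linFamily_smul ρ hχ hβ _ y).trans ?_
    rw [average_eq_sum hy]
    simp [smul_smul, mul_assoc]
  refine (diffOp_congr h2 c).trans ?_
  rw [diffOp_sum (f := fun γ y => (ContinuousLinearMap.id ℝ ℝ).smulRight
    (linPart ρ γ (d⁻¹ • v)) (χ (γ⁻¹ • y) * f (γ⁻¹ • y))) _ fun γ => ContDiff.comp
    (g := ((ContinuousLinearMap.id ℝ ℝ).smulRight (linPart ρ γ (d⁻¹ • v)) : ℝ → Euc q))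
    (ContinuousLinearMap.contDiff _) (hterm γ)]
  simp_rw [fun γ : Γ => diffOp_clm_comp ((ContinuousLinearMap.id ℝ ℝ).smulRight
    (linPart ρ γ (d⁻¹ • v))) (hterm γ) x c]
  rw [Finset.sum_eq_single 1]
  · change d • linPart ρ 1 (d⁻¹ • v) = v
    rw [linPart_one, smul_smul, mul_inv_cancel₀ hone, one_smul]
  · intro γ _ hγ
    rw [hvan γ hγ, map_zero]
  · exact fun h => absurd (Finset.mem_insert_self _ _) h

/-- A polynomial vanishing at the relevant points of both orbits except `x` makes the value at `y`
zero and leaves only the `γ = 1` term at `x`. -/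
theorem surjective_linFamily_sub (hχ : HasCompactSupport χ)
    (h1 : ∀ x : Euc n, average χ (fun (_ : Γ) _ => (1 : ℝ)) x = 1)
    (hfree : ∀ γ : Γ, γ ≠ 1 → ∀ x : Euc n, γ • x ≠ x) {T : Finset Γ}
    (hT : ∀ (γ : Γ) (x : Euc n), x ∈ tsupport χ → γ • x ∈ tsupport χ → γ ∈ T)
    (hspan : ∀ f ∈ affineFunctions n ^ (2 + 4 * (2 * T.card)),
      ∃ β : Fin m → ℝ, ∀ z, f z = ∑ i, β i * h i z)
    {x y : Euc n} (hx : χ x ≠ 0) (hxy : ∀ γ : Γ, γ • y ≠ x) :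
    Function.Surjective (linFamily ρ χ h x - linFamily ρ χ h y) := by
  classical
  -- The point `y` may be far from the support of `χ`. Once it is moved there by `γ₀⁻¹`, the
  -- translates of `y` in the support are among those by `T`, so at most `2 * T.card` points are
  -- needed in all.
  obtain ⟨γ₀, hγ₀⟩ : ∃ γ : Γ, χ (γ⁻¹ • y) ≠ 0 := by
    by_contra! hcon
    have := h1 y
    rw [average_eq_sum (t := ∅) (fun γ hγ => absurd (hcon γ) hγ), Finset.sum_empty] at this
    exact zero_ne_one this
  let w : Γ ⊕ Γ → Euc n := Sum.elim (fun δ => δ • x) (fun δ => δ • γ₀⁻¹ • y)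
  let W : Finset (Γ ⊕ Γ) := (T.erase 1).disjSum T
  let f : Euc n → ℝ := fun z => ∏ i ∈ W, (‖z - w i‖ ^ 2) ^ 2
  have hf : f ∈ affineFunctions n ^ (2 + 4 * (2 * T.card)) := by
    refine mem_affineFunctions_pow_of_le ?_ (prod_normSq_mem W w)
    have := Finset.card_erase_le (a := (1 : Γ)) (s := T)
    rw [Finset.card_disjSum]
    omega
  obtain ⟨β, hβ⟩ := hspan f hf
  have hf0 : ∀ i ∈ W, f (w i) = 0 := fun i hi =>
    Finset.prod_eq_zero hi (by simp)
  have hfx : f x ≠ 0 := by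
    refine Finset.prod_ne_zero_iff.2 fun i hi => ?_
    have : x - w i ≠ 0 := by
      rcases i with δ | δ
      · have hδ : δ ∈ T.erase 1 := by simpa [W] using hi
        exact sub_ne_zero.2 (hfree δ (Finset.ne_of_mem_erase hδ) x).symm
      · refine sub_ne_zero.2 fun h => hxy (δ * γ₀⁻¹) ?_
        rw [mul_smul]; exact h.symm
    positivity
  intro v
  let d := χ x * f x
  have hd : d ≠ 0 := mul_ne_zero hx hfx
  refine ⟨fun i => β i • d⁻¹ • v, ?_⟩
  rw [sub_apply, linFamily_smul ρ hχ hβ, linFamily_smul ρ hχ hβ]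
  have hy : average χ (fun (γ : Γ) z => f (γ⁻¹ • z) • linPart ρ γ (d⁻¹ • v)) y = 0 := by
    refine finsum_eq_zero_of_forall_eq_zero fun γ => ?_
    by_cases hγ : χ (γ⁻¹ • y) = 0
    · rw [hγ, zero_smul]
    · have hmem : Sum.inr (γ⁻¹ * γ₀) ∈ W := by
        simp only [W, Finset.inr_mem_disjSum]
        refine hT _ (γ₀⁻¹ • y) (subset_tsupport _ hγ₀) ?_
        rw [mul_smul, smul_inv_smul]
        exact subset_tsupport _ hγ
      have := hf0 _ hmem
      simp only [w, Sum.elim_inr, mul_smul, smul_inv_smul] at this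
      beta_reduce
      rw [this, zero_smul, smul_zero]
  have hx' : average χ (fun (γ : Γ) z => f (γ⁻¹ • z) • linPart ρ γ (d⁻¹ • v)) x = v := by
    refine (finsum_eq_single _ 1 fun γ hγ1 => ?_).trans ?_
    · by_cases hγ : χ (γ⁻¹ • x) = 0
      · rw [hγ, zero_smul]
      · have hmem : Sum.inl γ⁻¹ ∈ W := by
          simp only [W, Finset.inl_mem_disjSum]
          exact Finset.mem_erase.2 ⟨inv_ne_one.2 hγ1,
            hT _ x (subset_tsupport _ hx) (subset_tsupport _ hγ)⟩
        have := hf0 _ hmem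
        simp only [w, Sum.elim_inl] at this
        beta_reduce
        rw [this, zero_smul, smul_zero]
    · beta_reduce
      rw [inv_one, one_smul, linPart_one, smul_smul, smul_smul]
      change (d * d⁻¹) • v = v
      rw [mul_inv_cancel₀ hd, one_smul]
  rw [hx', hy, sub_zero]

end Surjectivity

/-! ### Existence of a generic parameter. -/

section Generic

variable {n q m : ℕ}

/-- The coefficients of a differential operator whose coefficient at `α` is one. -/
def normalizedCoeff (α : JetIndex n) (c : {β : JetIndex n // β ≠ α} → ℝ) (β : JetIndex n) : ℝ :=
  if h : β = α then 1 else c ⟨β, h⟩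

theorem normalizedCoeff_ne_zero (α : JetIndex n) (c : {β : JetIndex n // β ≠ α} → ℝ) :
    normalizedCoeff α c ≠ 0 := by
  refine Function.ne_iff.2 ⟨α, ?_⟩
  simp [normalizedCoeff]

theorem contDiff_diffOp_normalizedCoeff {F : Type*} [NormedAddCommGroup F] [NormedSpace ℝ F]
    (α : JetIndex n) {f : Euc n → F} (hf : ContDiff ℝ ∞ f) :
    ContDiff ℝ 1 fun p : ({β : JetIndex n // β ≠ α} → ℝ) × Euc n =>
      diffOp (normalizedCoeff α p.1) f p.2 := by
  refine ContDiff.sum fun β _ => ContDiff.smul ?_ ?_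
  · by_cases h : β = α
    · simpa [normalizedCoeff, h] using contDiff_const
    · simp only [normalizedCoeff, h, dite_false]
      exact (contDiff_apply ℝ ℝ _).comp contDiff_fst
  · exact ((contDiff_jet hf β).of_le (by exact_mod_cast le_top)).comp contDiff_snd

variable {Γ : Type*} [Group Γ] [MulAction Γ (Euc n)] (ρ : Γ →* (Euc q ≃ᵃⁱ[ℝ] Euc q))
  [ProperlyDiscontinuousSMul Γ (Euc n)] {χ : Euc n → ℝ} {h : Fin m → Euc n → ℝ}

theorem diffOp_family (hχ : HasCompactSupport χ) (hχs : ContDiff ℝ ∞ χ)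
    (hsm : ∀ γ : Γ, ContDiff ℝ ∞ (fun x : Euc n => γ • x)) (hh : ∀ i, ContDiff ℝ ∞ (h i))
    (a : Fin m → Euc q) (c : JetIndex n → ℝ) (x : Euc n) :
    diffOp c (family ρ χ h a) x =
      (diffOp c (linFamily ρ χ h) x : (Fin m → Euc q) →L[ℝ] Euc q) a +
        diffOp c (constFamily ρ χ) x := by
  have h1 := contDiff_linFamily ρ hχ hχs hsm hh
  have h2 := diffOp_clm_comp (ContinuousLinearMap.apply ℝ (Euc q) a) h1 x c
  refine (diffOp_add (f := fun y => linFamily ρ χ h y a) (h1.clm_apply contDiff_const)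
    (contDiff_constFamily ρ hχ hχs hsm) x c).trans ?_
  congr 1

/-- For a generic parameter the equivariant map is free and separates the orbits. -/
theorem exists_generic_parameter (hn : 0 < n) (hq : q = s n + 2 * n)
    (hχ : HasCompactSupport χ) (hχs : ContDiff ℝ ∞ χ)
    (h1 : ∀ x : Euc n, average χ (fun (_ : Γ) _ => (1 : ℝ)) x = 1)
    (hsm : ∀ γ : Γ, ContDiff ℝ ∞ (fun x : Euc n => γ • x)) (hh : ∀ i, ContDiff ℝ ∞ (h i))
    (hfree : ∀ γ : Γ, γ ≠ 1 → ∀ x : Euc n, γ • x ≠ x) {T : Finset Γ}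
    (hT : ∀ (γ : Γ) (x : Euc n), x ∈ tsupport χ → γ • x ∈ tsupport χ → γ ∈ T)
    (hspan : ∀ f ∈ affineFunctions n ^ (2 + 4 * (2 * T.card)),
      ∃ β : Fin m → ℝ, ∀ z, f z = ∑ i, β i * h i z) :
    ∃ a : Fin m → Euc q,
      (∀ x, χ x ≠ 0 → LinearIndependent ℝ (jet (family ρ χ h a) x)) ∧
      ∀ x y, χ x ≠ 0 → (∀ γ : Γ, γ • y ≠ x) → family ρ χ h a x ≠ family ρ χ h a y := by
  have hL := contDiff_linFamily ρ hχ hχs hsm hh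
  have hb := contDiff_constFamily ρ hχ hχs hsm
  have hs : 0 < s n := by
    rw [s_eq_sum]
    exact Finset.sum_pos (fun i _ => Nat.succ_pos i) ⟨0, Finset.mem_range.2 hn⟩
  -- A positive-dimensional parameter space is needed for the truncated bound `dim - 1` to be
  -- strict.
  have hm : 0 < m := by
    by_contra hm
    obtain ⟨β, hβ⟩ := hspan 1 (mem_affineFunctions_pow_of_le (Nat.zero_le _)
      (by rw [pow_zero]; exact Submodule.one_le.1 le_rfl))
    have : IsEmpty (Fin m) := by
      rw [Nat.eq_zero_of_not_pos hm]; infer_instance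
    simpa using hβ 0
  let B₁ : JetIndex n → Set (Fin m → Euc q) := fun α =>
    {a | ∃ p : ({β : JetIndex n // β ≠ α} → ℝ) × Euc n,
      Function.Surjective (diffOp (F := (Fin m → Euc q) →L[ℝ] Euc q) (normalizedCoeff α p.1)
        (linFamily ρ χ h) p.2) ∧
      diffOp (F := (Fin m → Euc q) →L[ℝ] Euc q) (normalizedCoeff α p.1)
        (linFamily ρ χ h) p.2 a + diffOp (normalizedCoeff α p.1) (constFamily ρ χ) p.2 = 0}
  let B₂ : Set (Fin m → Euc q) :=
    {a | ∃ p : Euc n × Euc n,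
      Function.Surjective (linFamily ρ χ h p.1 - linFamily ρ χ h p.2) ∧
      (linFamily ρ χ h p.1 - linFamily ρ χ h p.2) a +
        (constFamily ρ χ p.1 - constFamily ρ χ p.2) = 0}
  have hB₁ : ∀ α, dimH (B₁ α) ≤ (finrank ℝ (Fin m → Euc q) - 1 : ℕ) := fun α => by
    refine dimH_zeros_le ?_ (contDiff_diffOp_normalizedCoeff α hL)
      (contDiff_diffOp_normalizedCoeff α hb)
    have hcard := card_jetIndex n
    have hcard' : Fintype.card {β : JetIndex n // β ≠ α} = n + s n - 1 := by
      rw [Fintype.card_subtype_compl, hcard]; simp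
    rw [finrank_prod, finrank_fintype_fun_eq_card, hcard', finrank_euclideanSpace_fin,
      finrank_euclideanSpace_fin]
    omega
  have hB₂ : dimH B₂ ≤ (finrank ℝ (Fin m → Euc q) - 1 : ℕ) := by
    have hL1 := hL.of_le (m := 1) (by exact_mod_cast le_top)
    have hb1 := hb.of_le (m := 1) (by exact_mod_cast le_top)
    refine dimH_zeros_le (P := Euc n × Euc n)
      (T := fun p => linFamily ρ χ h p.1 - linFamily ρ χ h p.2)
      (b := fun p => constFamily ρ χ p.1 - constFamily ρ χ p.2) ?_
      ((hL1.comp contDiff_fst).sub (hL1.comp contDiff_snd))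
      ((hb1.comp contDiff_fst).sub (hb1.comp contDiff_snd))
    rw [finrank_prod, finrank_euclideanSpace_fin, finrank_euclideanSpace_fin]
    -- Here `2 * n < s n + 2 * n`, because `s n` is positive when `n` is.
    omega
  have hpos : 0 < finrank ℝ (Fin m → Euc q) := by
    rw [finrank_pi_fintype]
    simp only [finrank_euclideanSpace_fin, Finset.sum_const, Finset.card_univ, Fintype.card_fin,
      smul_eq_mul]
    exact Nat.mul_pos hm (by omega)
  have hdim : dimH ((⋃ α, B₁ α) ∪ B₂) < finrank ℝ (Fin m → Euc q) := by
    rw [dimH_union, dimH_iUnion]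
    refine (max_le (iSup_le hB₁) hB₂).trans_lt ?_
    exact_mod_cast Nat.sub_lt hpos one_pos
  obtain ⟨a, ha⟩ := (dense_compl_of_dimH_lt_finrank hdim).nonempty
  rw [mem_compl_iff, mem_union, not_or, mem_iUnion, not_exists] at ha
  refine ⟨a, fun x hx => ?_, fun x y hx hxy heq => ha.2 ⟨(x, y),
    surjective_linFamily_sub ρ hχ h1 hfree hT hspan hx hxy, ?_⟩⟩
  · rw [Fintype.linearIndependent_iff]
    intro c hc
    by_contra! hcon
    obtain ⟨α, hα⟩ := hcon
    -- Dividing a relation by a nonzero coefficient puts it in one of the finitely many normalized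
    -- families.
    let c' : {β : JetIndex n // β ≠ α} → ℝ := fun β => (c α)⁻¹ * c β
    have hc' : normalizedCoeff α c' = fun β => (c α)⁻¹ * c β := by
      funext β
      by_cases hβ : β = α
      · subst hβ; simp [normalizedCoeff, hα]
      · simp [normalizedCoeff, hβ, c']
    refine ha.1 α ⟨(c', x), surjective_diffOp_linFamily ρ hχ hχs hsm hh hfree hT hspan hx
      (normalizedCoeff_ne_zero α c'), ?_⟩
    rw [← diffOp_family ρ hχ hχs hsm hh, hc', diffOp]
    simp only [mul_smul]
    rw [← Finset.smul_sum, hc, smul_zero]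
  · rw [family, family, ← sub_eq_zero] at heq
    rw [sub_apply, ← heq]
    abel

end Generic

/-! ### The equivariant free embedding of `ℝ^n`. -/

section Core

variable {n q k : ℕ} {Γ : Type*} [Group Γ]

/-- The product of an isometry with the identity. -/
def prodIsometry (k : ℕ) (φ : Euc n ≃ᵃⁱ[ℝ] Euc n) :
    WithLp 2 (Euc n × Euc k) ≃ᵃⁱ[ℝ] WithLp 2 (Euc n × Euc k) :=
  (IsometryEquiv.mk' (fun z => WithLp.toLp 2 (φ z.fst, z.snd))
    (fun z => WithLp.toLp 2 (φ.symm z.fst, z.snd)) (fun z => by simp; rfl)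
    (Isometry.of_dist_eq fun z w => by
      simp [WithLp.prod_dist_eq_of_L2])).toRealAffineIsometryEquiv

theorem prodIsometry_apply (φ : Euc n ≃ᵃⁱ[ℝ] Euc n) (z : WithLp 2 (Euc n × Euc k)) :
    prodIsometry k φ z = WithLp.toLp 2 (φ z.fst, z.snd) := rfl

/-- An isometric action on `ℝ^n` extends to a Euclidean space of larger dimension. -/
theorem exists_extended_action (σ : Γ →* (Euc n ≃ᵃⁱ[ℝ] Euc n)) (hq : q = n + k) :
    ∃ (ρ : Γ →* (Euc q ≃ᵃⁱ[ℝ] Euc q)) (π : Euc q → Euc n), Continuous π ∧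
      ∀ γ z, π (ρ γ z) = σ γ (π z) := by
  have hrank : finrank ℝ (WithLp 2 (Euc n × Euc k)) = q := by
    rw [(WithLp.linearEquiv 2 ℝ (Euc n × Euc k)).finrank_eq, finrank_prod,
      finrank_euclideanSpace_fin, finrank_euclideanSpace_fin, hq]
  let e : WithLp 2 (Euc n × Euc k) ≃ᵃⁱ[ℝ] Euc q :=
    ((stdOrthonormalBasis ℝ (WithLp 2 (Euc n × Euc k))).reindex
      (finCongr hrank)).repr.toAffineIsometryEquiv
  refine ⟨{ toFun := fun γ => (e.symm.trans (prodIsometry k (σ γ))).trans e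
            map_one' := ?_, map_mul' := fun γ δ => ?_ }, fun z => (e.symm z).fst, ?_, ?_⟩
  · refine AffineIsometryEquiv.ext fun z => ?_
    simp only [map_one, AffineIsometryEquiv.coe_trans, Function.comp_apply, prodIsometry_apply,
      AffineIsometryEquiv.coe_one, id]
    exact e.apply_symm_apply z
  · refine AffineIsometryEquiv.ext fun z => ?_
    simp [prodIsometry_apply]
  · exact (continuous_fst.comp (WithLp.prod_continuous_ofLp 2 _ _)).comp e.symm.continuous
  · intro γ z
    simp [prodIsometry_apply]

/-- Proper discontinuity makes point stabilizers finite, so this yields freeness of both actions, on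
the source and on `ℝ^n` through `σ`. -/
theorem eq_one_of_finite_stabilizer (hΓ : ∀ γ : Γ, γ ≠ 1 → ¬ IsOfFinOrder γ) {S : Set Γ}
    (hS : S.Finite) {γ : Γ} (hγ : ∀ k : ℕ, γ ^ k ∈ S) : γ = 1 := by
  by_contra hne
  have hinj := injective_pow_iff_not_isOfFinOrder.2 (hΓ γ hne)
  exact (infinite_range_of_injective hinj) (hS.subset (range_subset_iff.2 hγ))

theorem exists_equiv_fderiv {τ τ' : Euc n → Euc n} {y : Euc n} (h : DifferentiableAt ℝ τ y)
    (h' : DifferentiableAt ℝ τ' (τ y)) (hinv : ∀ᶠ z in 𝓝 y, τ' (τ z) = z) :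
    ∃ T : Euc n ≃L[ℝ] Euc n, fderiv ℝ τ y = T := by
  have h1 : (fderiv ℝ τ' (τ y)).comp (fderiv ℝ τ y) = ContinuousLinearMap.id ℝ (Euc n) := by
    rw [← fderiv_comp y h' h, ← fderiv_id (x := y)]
    exact EventuallyEq.fderiv_eq hinv
  have hinj : Function.Injective (fderiv ℝ τ y).toLinearMap := by
    refine Function.LeftInverse.injective (g := fderiv ℝ τ' (τ y)) fun v => ?_
    exact congrArg (fun L : Euc n →L[ℝ] Euc n => L v) h1
  refine ⟨(LinearEquiv.ofInjectiveEndo _ hinj).toContinuousLinearEquiv, ?_⟩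
  ext v
  rfl

theorem linearIndependent_jet_affine {f : Euc n → Euc q} {y : Euc n} (hf : ContDiff ℝ ∞ f)
    (L : Euc q →L[ℝ] Euc q) (hL : Function.Injective L) (w : Euc q)
    (h : LinearIndependent ℝ (jet f y)) : LinearIndependent ℝ (jet (fun z => L (f z) + w) y) := by
  have heq : jet (fun z => L (f z) + w) y = L.toLinearMap ∘ jet f y := by
    funext α
    rw [jet_add (f := fun z => L (f z)) (L.contDiff.comp hf) contDiff_const, jet_clm_comp L hf]
    rcases α with i | p <;> simp [jet, pd_const]
  rw [heq]
  exact h.map' _ (LinearMap.ker_eq_bot.2 hL)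

/-- The theorem for smooth actions on `ℝ^n` itself, without the metric. -/
theorem exists_equivariant_free_embedding [MulAction Γ (Euc n)]
    [ProperlyDiscontinuousSMul Γ (Euc n)]
    (hsm : ∀ γ : Γ, ContDiff ℝ ∞ (fun x : Euc n => γ • x))
    (hcc : ∃ K : Set (Euc n), IsCompact K ∧ ∀ x, ∃ γ : Γ, γ • x ∈ K)
    (hΓ : IsBieberbachGroup n Γ) :
    ∃ (u : Euc n → Euc (s n + 2 * n))
      (ρ : Γ →* (Euc (s n + 2 * n) ≃ᵃⁱ[ℝ] Euc (s n + 2 * n))),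
      ContDiff ℝ ∞ u ∧ IsClosedEmbedding u ∧ (∀ y, LinearIndependent ℝ (jet u y)) ∧
      ∀ γ x, u (γ • x) = ρ γ (u x) := by
  classical
  obtain ⟨htf, σ, -, hσ, -⟩ := hΓ
  -- For `n = 0` the target is a point and the strict inequality `2 * n < q` fails, so this case is
  -- separate.
  rcases Nat.eq_zero_or_pos n with rfl | hn
  · refine ⟨fun _ => 0, 1, contDiff_const, ?_, fun y => ?_, fun γ x => rfl⟩
    · exact IsClosedEmbedding.of_continuous_injective_isClosedMap continuous_const
        (fun x y _ => Subsingleton.elim x y) fun t _ => (toFinite _).isClosed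
    · have : IsEmpty (JetIndex 0) := ⟨fun α => by
        rcases α with i | p
        · exact i.elim0
        · exact p.1.1.elim0⟩
      exact linearIndependent_empty_type
  have hfree : ∀ γ : Γ, γ ≠ 1 → ∀ x : Euc n, γ • x ≠ x := by
    intro γ hγ x hx
    refine hγ (eq_one_of_finite_stabilizer htf
      (ProperlyDiscontinuousSMul.finite_disjoint_inter_image (Γ := Γ)
        (isCompact_singleton (x := x)) (isCompact_singleton (x := x))) fun k => ?_)
    refine ⟨x, ⟨x, rfl, ?_⟩, rfl⟩
    induction k with
    | zero => simp
    | succ k ih => simp only [pow_succ, mul_smul, hx]; exact ih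
  have hσfree : ∀ γ : Γ, γ ≠ 1 → ∀ x : Euc n, σ γ x ≠ x := by
    intro γ hγ x hx
    refine hγ (eq_one_of_finite_stabilizer htf (hσ {x} isCompact_singleton) fun k => ?_)
    refine ⟨x, ⟨x, rfl, ?_⟩, rfl⟩
    induction k with
    | zero => simp
    | succ k ih => rw [pow_succ, map_mul]; exact (congrArg _ hx).trans ih
  obtain ⟨ρ, π, hπ, hρ⟩ := exists_extended_action (q := s n + 2 * n) (k := s n + n) σ (by ring)
  obtain ⟨χ, hχs, hχ, h1⟩ := exists_average_eq_one Γ hsm hcc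
  have hTfin := ProperlyDiscontinuousSMul.finite_disjoint_inter_image (Γ := Γ)
    hχ.isCompact hχ.isCompact
  let T : Finset Γ := hTfin.toFinset
  have hT : ∀ (γ : Γ) (x : Euc n), x ∈ tsupport χ → γ • x ∈ tsupport χ → γ ∈ T :=
    fun γ x hx hγ => hTfin.mem_toFinset.2 ⟨γ • x, ⟨x, hx, rfl⟩, hγ⟩
  obtain ⟨m, h, hh, hspan⟩ := exists_family_affineFunctions_pow n (2 + 4 * (2 * T.card))
  obtain ⟨a, hafree, hasep⟩ :=
    exists_generic_parameter ρ hn rfl hχ hχs h1 hsm hh hfree hT hspan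
  let u : Euc n → Euc (s n + 2 * n) := family ρ χ h a
  have hu : ContDiff ℝ ∞ u := ((contDiff_linFamily ρ hχ hχs hsm hh).clm_apply
    contDiff_const).add (contDiff_constFamily ρ hχ hχs hsm)
  have hequiv : ∀ γ x, u (γ • x) = ρ γ (u x) := fun γ x => family_smul ρ hχ h1 a γ x
  have hex : ∀ x : Euc n, ∃ γ : Γ, χ (γ⁻¹ • x) ≠ 0 := by
    intro x
    by_contra! hcon
    have := h1 x
    rw [average_eq_sum (t := ∅) (fun γ hγ => absurd (hcon γ) hγ), Finset.sum_empty] at this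
    exact zero_ne_one this
  have hinj : Function.Injective u := by
    intro x y hxy
    by_cases horb : ∃ γ : Γ, γ • y = x
    · obtain ⟨γ, rfl⟩ := horb
      rw [hequiv] at hxy
      by_cases hγ : γ = 1
      · rw [hγ, one_smul]
      -- Equal values on one orbit would give `σ γ` the fixed point `π (u y)`.
      · exact absurd (by rw [← hρ, hxy]) (hσfree γ hγ (π (u y)))
    · push Not at horb
      obtain ⟨γ, hγ⟩ := hex x
      refine absurd ?_ (hasep (γ⁻¹ • x) (γ⁻¹ • y) hγ fun δ hδ => horb (γ * δ * γ⁻¹) ?_)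
      · change u _ = u _
        rw [hequiv, hequiv, hxy]
      · rw [mul_smul, mul_smul, hδ, smul_inv_smul]
  have hproper : IsProperMap u := by
    rw [isProperMap_iff_tendsto_cocompact]
    refine ⟨hu.continuous, ?_⟩
    obtain ⟨K, hK, hKcov⟩ := hcc
    rw [hasBasis_cocompact.tendsto_right_iff]
    intro L hL
    -- If `u x ∈ L` and `γ • x ∈ K`, then `σ γ⁻¹` carries a point of `π '' (u '' K)` into `π '' L`.
    -- Only finitely many `γ⁻¹` do this, so `x` lies in a finite union of translates of `K`.
    let C : Set (Euc n) := π '' (u '' K) ∪ π '' L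
    have hC : IsCompact C := ((hK.image hu.continuous).image hπ).union (hL.image hπ)
    have hK' : IsCompact (⋃ γ ∈ (hσ C hC).toFinset, (fun x : Euc n => γ • x) '' K) :=
      (hσ C hC).toFinset.isCompact_biUnion fun γ _ => hK.image (hsm γ).continuous
    filter_upwards [hK'.compl_mem_cocompact] with x hx hxL
    refine hx ?_
    obtain ⟨γ, hγ⟩ := hKcov x
    refine mem_iUnion₂.2 ⟨γ⁻¹, ?_, γ • x, hγ, inv_smul_smul γ x⟩
    rw [Finite.mem_toFinset]
    refine ⟨π (u x), ⟨π (u (γ • x)), Or.inl ⟨_, ⟨_, hγ, rfl⟩, rfl⟩, ?_⟩, Or.inr ⟨_, hxL, rfl⟩⟩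
    rw [← hρ, ← hequiv, inv_smul_smul]
  refine ⟨u, ρ, hu, IsClosedEmbedding.of_continuous_injective_isClosedMap hu.continuous hinj
    hproper.isClosedMap, fun x => ?_, hequiv⟩
  -- Independence is known only where `χ ≠ 0`; the identity `u z = ρ γ (u (γ⁻¹ • z))` spreads it
  -- everywhere.
  obtain ⟨γ, hγ⟩ := hex x
  have hinv : ∀ z : Euc n, γ • γ⁻¹ • z = z := smul_inv_smul γ
  obtain ⟨S, hS⟩ := exists_equiv_fderiv (y := x) ((hsm γ⁻¹).differentiable (by simp) x)
    ((hsm γ).differentiable (by simp) _) (Eventually.of_forall hinv)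
  have hcomp := linearIndependent_jet_comp hu.contDiffAt (hsm γ⁻¹).contDiffAt S hS
    (hafree _ hγ)
  have := linearIndependent_jet_affine (hu.comp (hsm γ⁻¹)) (linPart ρ γ)
    (ρ γ).linearIsometryEquiv.injective (ρ γ 0) hcomp
  convert this using 2
  funext z
  rw [← action_apply, Function.comp_apply, ← hequiv, hinv]

end Core

/-! ### Local comparison of `du · du` with the metric. -/

section ManifoldSide

variable {n q k : ℕ} {M : Type*} [TopologicalSpace M] [ChartedSpace (Euc n) M]

open Bundle in
theorem eventually_norm_trivialization_le [IsManifold (𝓡 n) ∞ M] (g : RiemMetric n M) (x : M) :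
    ∃ C > 0, ∀ᶠ y in 𝓝 x, ∀ v : TangentSpace (𝓡 n) y,
      ‖(trivializationAt (Euc n) (fun x : M => TangentSpace (𝓡 n) x) x).continuousLinearMapAt ℝ y
        v‖ ≤ C * √(g.inner y v v) := by
  let _ : RiemannianBundle (fun x : M => TangentSpace (𝓡 n) x) := ⟨g.toRiemannianMetric⟩
  have _ : IsContinuousRiemannianBundle (Euc n) (fun x : M => TangentSpace (𝓡 n) x) :=
    ⟨⟨g.inner, g.contMDiff.continuous, fun _ _ _ => rfl⟩⟩
  obtain ⟨C, hC, h⟩ :=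
    eventually_norm_trivializationAt_lt (Euc n) (fun x : M => TangentSpace (𝓡 n) x) x
  refine ⟨C, hC, ?_⟩
  filter_upwards [h] with y hy v
  have h1 : ‖v‖ = √(g.inner y v v) := by
    rw [norm_eq_sqrt_real_inner]; rfl
  rw [← h1]
  exact (ContinuousLinearMap.le_opNorm _ v).trans (by gcongr)

/-- On a neighbourhood of each point, `du · du` is bounded by a multiple of the metric. -/
theorem eventually_inducedForm_le [IsManifold (𝓡 n) ∞ M] (g : RiemMetric n M) {u : M → Euc q}
    (hu : ContMDiff (𝓡 n) (𝓡 q) ∞ u) (x : M) :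
    ∃ C > 0, ∀ᶠ y in 𝓝 x, ∀ v : TangentSpace (𝓡 n) y,
      inducedForm u y v v ≤ C * g.inner y v v := by
  obtain ⟨C, hC, h⟩ := eventually_norm_trivialization_le g x
  let w : Euc n → Euc q := u ∘ (chartAt (Euc n) x).symm
  have hw : ContDiffOn ℝ ∞ w (chartAt (Euc n) x).target := by
    rw [← contMDiffOn_iff_contDiffOn]
    exact hu.comp_contMDiffOn (contMDiffOn_chart_symm)
  have hopen := (chartAt (Euc n) x).open_target
  have hwc : ContinuousAt (fderiv ℝ w) (chartAt (Euc n) x x) :=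
    (hw.continuousOn_fderiv_of_isOpen hopen (by simp)).continuousAt
      (hopen.mem_nhds (mem_chart_target _ x))
  have hbd : ∀ᶠ y in 𝓝 x, ‖fderiv ℝ w (chartAt (Euc n) x y)‖ <
      ‖fderiv ℝ w (chartAt (Euc n) x x)‖ + 1 :=
    ((hwc.norm).comp (f := chartAt (Euc n) x) (x := x)
      ((chartAt (Euc n) x).continuousAt (mem_chart_source _ x))).eventually_lt
      continuousAt_const (by simp)
  set D := ‖fderiv ℝ w (chartAt (Euc n) x x)‖ + 1 with hD
  have hDpos : 0 < D := by positivity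
  refine ⟨(D * C) ^ 2, by positivity, ?_⟩
  filter_upwards [h, hbd, (chartAt (Euc n) x).open_source.mem_nhds (mem_chart_source _ x)]
    with y hy hyD hys v
  have hchart : MDifferentiableAt (𝓡 n) (𝓡 n) (chartAt (Euc n) x) y :=
    mdifferentiableAt_atlas (chart_mem_atlas _ x) hys
  have hwd : MDifferentiableAt (𝓡 n) (𝓡 q) w (chartAt (Euc n) x y) :=
    (((hw.contDiffAt (hopen.mem_nhds ((chartAt (Euc n) x).map_source hys))).differentiableAt
      (by simp))).mdifferentiableAt
  have hcomp : mfderiv (𝓡 n) (𝓡 q) u y = (mfderiv (𝓡 n) (𝓡 q) w (chartAt (Euc n) x y)).comp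
      (mfderiv (𝓡 n) (𝓡 n) (chartAt (Euc n) x) y) := by
    rw [← mfderiv_comp y hwd hchart]
    refine EventuallyEq.mfderiv_eq ?_
    filter_upwards [(chartAt (Euc n) x).open_source.mem_nhds hys] with z hz
    simp [w, (chartAt (Euc n) x).left_inv hz]
  have htriv := TangentBundle.continuousLinearMapAt_trivializationAt (I := 𝓡 n) hys
  have hy' : norm (E := Euc n) (mfderiv (𝓡 n) (𝓡 n) (chartAt (Euc n) x) y v) ≤ C * √(g.inner y v v) := by
    have := hy v
    rwa [htriv] at this
  have hdu : norm (E := Euc q) (mfderiv (𝓡 n) (𝓡 q) u y v) ≤ D * C * √(g.inner y v v) := by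
    have e : mfderiv (𝓡 n) (𝓡 q) u y v = fderiv ℝ w (chartAt (Euc n) x y)
        (mfderiv (𝓡 n) (𝓡 n) (chartAt (Euc n) x) y v) := by
      rw [hcomp, ← mfderiv_eq_fderiv]
      rfl
    rw [e, mul_assoc]
    refine (ContinuousLinearMap.le_opNorm (fderiv ℝ w (chartAt (Euc n) x y)) _).trans ?_
    exact mul_le_mul hyD.le hy' (norm_nonneg _) hDpos.le
  have hg : 0 ≤ g.inner y v v := by
    rcases eq_or_ne v 0 with rfl | hv
    · simp
    · exact (g.pos y v hv).le
  calc inducedForm u y v v = norm (E := Euc q) (mfderiv (𝓡 n) (𝓡 q) u y v) ^ 2 :=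
        real_inner_self_eq_norm_sq _
    _ ≤ (D * C * √(g.inner y v v)) ^ 2 := pow_le_pow_left₀ (norm_nonneg _) hdu 2
    _ = (D * C) ^ 2 * g.inner y v v := by rw [mul_pow _ (√ _), Real.sq_sqrt hg]

end ManifoldSide

/-! ### Shortness after a homothety. -/

section Shortness

variable {n q : ℕ} {M : Type*} [TopologicalSpace M] [ChartedSpace (Euc n) M]

theorem mfderiv_affine_comp {q' : ℕ} {u : M → Euc q} (hu : ContMDiff (𝓡 n) (𝓡 q) ∞ u)
    (L : Euc q →L[ℝ] Euc q') (w : Euc q') (x : M) (v : TangentSpace (𝓡 n) x) :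
    mfderiv (𝓡 n) (𝓡 q') (fun y => L (u y) + w) x v = L (mfderiv (𝓡 n) (𝓡 q) u x v) := by
  have hux : MDifferentiableAt (𝓡 n) (𝓡 q) u x := hu.mdifferentiableAt (by simp)
  have hL : HasFDerivAt (fun z => L z + w) L (u x) := L.hasFDerivAt.add_const w
  have := (hL.hasMFDerivAt.comp x hux.hasMFDerivAt).mfderiv
  exact congrArg (fun T : Euc n →L[ℝ] Euc q' => T v) this

theorem inducedForm_smul_eq {Γ : Type*} [Group Γ] [MulAction Γ M] {u : M → Euc q}
    (hu : ContMDiff (𝓡 n) (𝓡 q) ∞ u) {ρ : Γ →* (Euc q ≃ᵃⁱ[ℝ] Euc q)}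
    (hρ : ∀ γ x, u (γ • x) = ρ γ (u x)) {γ : Γ}
    (hγ : ContMDiff (𝓡 n) (𝓡 n) ∞ (fun x : M => γ • x)) (x : M) (v : TangentSpace (𝓡 n) x) :
    inducedForm u (γ • x) (mfderiv (𝓡 n) (𝓡 n) (fun y : M => γ • y) x v)
      (mfderiv (𝓡 n) (𝓡 n) (fun y : M => γ • y) x v) = inducedForm u x v v := by
  have h1 : mfderiv (𝓡 n) (𝓡 q) (fun y => u (γ • y)) x =
      (mfderiv (𝓡 n) (𝓡 q) u (γ • x)).comp (mfderiv (𝓡 n) (𝓡 n) (fun y : M => γ • y) x) :=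
    mfderiv_comp x (hu.mdifferentiableAt (by simp)) (hγ.mdifferentiableAt (by simp))
  have h2 : (fun y => u (γ • y)) = fun y => linPart ρ γ (u y) + ρ γ 0 := by
    funext y; rw [hρ, action_apply]
  have h3 : mfderiv (𝓡 n) (𝓡 q) u (γ • x) (mfderiv (𝓡 n) (𝓡 n) (fun y : M => γ • y) x v) =
      linPart ρ γ (mfderiv (𝓡 n) (𝓡 q) u x v) := by
    rw [← mfderiv_affine_comp hu (linPart ρ γ) (ρ γ 0), ← h2, h1]
    rfl
  rw [inducedForm, h3]
  exact (ρ γ).linearIsometryEquiv.inner_map_map _ _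

variable [IsManifold (𝓡 n) ∞ M]

theorem metric_self_nonneg (g : RiemMetric n M) (x : M) (v : TangentSpace (𝓡 n) x) :
    0 ≤ g.inner x v v := by
  rcases eq_or_ne v 0 with rfl | hv
  · simp
  · exact (g.pos x v hv).le

theorem exists_inducedForm_le_of_isCompact (g : RiemMetric n M) {u : M → Euc q}
    (hu : ContMDiff (𝓡 n) (𝓡 q) ∞ u) {K : Set M} (hK : IsCompact K) :
    ∃ C > 0, ∀ x ∈ K, ∀ v : TangentSpace (𝓡 n) x, inducedForm u x v v ≤ C * g.inner x v v := by
  refine hK.induction_on (p := fun S => ∃ C > 0, ∀ x ∈ S, ∀ v : TangentSpace (𝓡 n) x,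
    inducedForm u x v v ≤ C * g.inner x v v) ⟨1, one_pos, fun x hx => absurd hx (notMem_empty x)⟩
    ?_ ?_ ?_
  · rintro S S' hS ⟨C, hC, h⟩
    exact ⟨C, hC, fun x hx => h x (hS hx)⟩
  · rintro S S' ⟨C, hC, h⟩ ⟨C', hC', h'⟩
    refine ⟨C + C', by positivity, fun x hx v => ?_⟩
    have hg := metric_self_nonneg g x v
    rcases hx with hx | hx
    · nlinarith [h x hx v, mul_nonneg hC'.le hg]
    · nlinarith [h' x hx v, mul_nonneg hC.le hg]
  · intro x _
    obtain ⟨C, hC, h⟩ := eventually_inducedForm_le g hu x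
    exact ⟨_, mem_nhdsWithin_of_mem_nhds h, C, hC, fun y hy => hy⟩

/-- A bound `C` on `K` holds everywhere by invariance of both forms. Scaling by `(C + 1)⁻¹`
multiplies `du · du` by `(C + 1)⁻²`, and `C < (C + 1)²`. -/
theorem exists_isShort_smul {Γ : Type*} [Group Γ] [MulAction Γ M] {g : RiemMetric n M}
    (hg : ActsByIsometries Γ g) {u : M → Euc q}
    (hu : ContMDiff (𝓡 n) (𝓡 q) ∞ u) {ρ : Γ →* (Euc q ≃ᵃⁱ[ℝ] Euc q)}
    (hρ : ∀ γ x, u (γ • x) = ρ γ (u x)) {K : Set M} (hK : IsCompact K)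
    (hcov : ∀ x : M, ∃ γ : Γ, γ • x ∈ K) :
    ∃ ε : ℝ, 0 < ε ∧ IsShort g (fun x => ε • u x) := by
  obtain ⟨C, hC, h⟩ := exists_inducedForm_le_of_isCompact g hu hK
  have hall : ∀ (x : M) (v : TangentSpace (𝓡 n) x), inducedForm u x v v ≤ C * g.inner x v v := by
    intro x v
    obtain ⟨γ, hγ⟩ := hcov x
    rw [← inducedForm_smul_eq hu hρ (hg γ).1, ← (hg γ).2]
    exact h _ hγ _
  refine ⟨(C + 1)⁻¹, by positivity, fun x v hv => ?_⟩
  have hd : mfderiv (𝓡 n) (𝓡 q) (fun y => (C + 1)⁻¹ • u y) x v =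
      (C + 1)⁻¹ • (mfderiv (𝓡 n) (𝓡 q) u x v : Euc q) := by
    have h1 := mfderiv_affine_comp hu ((C + 1)⁻¹ • ContinuousLinearMap.id ℝ (Euc q)) 0 x v
    have h2 : (fun y => ((C + 1)⁻¹ • ContinuousLinearMap.id ℝ (Euc q)) (u y) + 0) =
        fun y => (C + 1)⁻¹ • u y := by
      funext y; simp
    rw [h2] at h1
    exact h1
  have hform : inducedForm (fun y => (C + 1)⁻¹ • u y) x v v =
      (C + 1)⁻¹ * ((C + 1)⁻¹ * inducedForm u x v v) := by
    rw [inducedForm, hd]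
    exact (real_inner_smul_left _ _ _).trans (congrArg _ (real_inner_smul_right _ _ _))
  have hpos := g.pos x v hv
  rw [hform, sub_pos]
  have hC1 : 0 < C + 1 := by positivity
  calc (C + 1)⁻¹ * ((C + 1)⁻¹ * inducedForm u x v v)
      ≤ (C + 1)⁻¹ * ((C + 1)⁻¹ * (C * g.inner x v v)) := by
        gcongr
        exact hall x v
    _ < g.inner x v v := by
        rw [inv_mul_lt_iff₀ hC1, inv_mul_lt_iff₀ hC1]
        nlinarith [mul_pos hC hpos, mul_pos (mul_pos hC hC) hpos]

end Shortness

/-! ### Freeness and smooth embedding on the manifold. -/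

section Immersion

variable {n q k : ℕ} {M : Type*} [TopologicalSpace M] [ChartedSpace (Euc n) M]

theorem isFreeMap_comp_diffeomorph (Ψ : M ≃ₘ^∞⟮𝓡 n, 𝓡 n⟯ Euc n)
    {f : Euc n → Euc q} (hf : ContDiff ℝ ∞ f) (hfree : ∀ y, LinearIndependent ℝ (jet f y)) :
    IsFreeMap n (f ∘ Ψ) := by
  intro φ hφ x hx
  have hτ : ContDiffAt ℝ ∞ (Ψ ∘ φ.symm) (φ x) := by
    rw [← contMDiffAt_iff_contDiffAt]
    exact Ψ.contMDiff.contMDiffAt.comp _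
      (contMDiffAt_symm_of_mem_maximalAtlas hφ (φ.map_source hx))
  have hxx : Ψ.symm ((Ψ ∘ φ.symm) (φ x)) = x := by
    rw [Function.comp_apply, Ψ.symm_apply_apply, φ.left_inv hx]
  have hτ' : ContDiffAt ℝ ∞ (φ ∘ Ψ.symm) ((Ψ ∘ φ.symm) (φ x)) := by
    rw [← contMDiffAt_iff_contDiffAt]
    refine ContMDiffAt.comp _ ?_ Ψ.symm.contMDiff.contMDiffAt
    rw [hxx]
    exact contMDiffAt_of_mem_maximalAtlas hφ hx
  obtain ⟨T, hT⟩ := exists_equiv_fderiv (hτ.differentiableAt (by simp))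
    (hτ'.differentiableAt (by simp)) (by
      filter_upwards [φ.open_target.mem_nhds (φ.map_source hx)] with z hz
      rw [Function.comp_apply, Function.comp_apply, Ψ.symm_apply_apply, φ.right_inv hz])
  exact linearIndependent_jet_comp hf.contDiffAt hτ T hT (hfree _)

/-- A smooth map with injective derivative extends to a local diffeomorphism of the product with
a complementary space. -/
theorem exists_local_straightening (hq : q = n + k) {f : Euc n → Euc q} (hf : ContDiff ℝ ∞ f)
    {y : Euc n} (hy : Function.Injective (fderiv ℝ f y)) :
    ∃ e : OpenPartialHomeomorph (Euc n × Euc k) (Euc q), (y, 0) ∈ e.source ∧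
      ContDiffOn ℝ ∞ e e.source ∧ ContDiffOn ℝ ∞ e.symm e.target ∧ ∀ z, e (z, 0) = f z := by
  obtain ⟨C, hC⟩ := Submodule.exists_isCompl (LinearMap.range (fderiv ℝ f y).toLinearMap)
  have hrank : finrank ℝ (Euc k) = finrank ℝ C := by
    have h1 := Submodule.finrank_add_eq_of_isCompl hC
    rw [LinearMap.finrank_range_of_inj hy, finrank_euclideanSpace_fin,
      finrank_euclideanSpace_fin] at h1
    rw [finrank_euclideanSpace_fin]
    omega
  let j : Euc k →L[ℝ] Euc q := C.subtypeL.comp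
    (ContinuousLinearEquiv.ofFinrankEq hrank : Euc k →L[ℝ] C)
  let H : Euc n × Euc k → Euc q := fun p => f p.1 + j p.2
  have hH : ContDiff ℝ ∞ H := (hf.comp contDiff_fst).add (j.contDiff.comp contDiff_snd)
  have hH' : HasFDerivAt H ((fderiv ℝ f y).comp (ContinuousLinearMap.fst ℝ _ _) +
      j.comp (ContinuousLinearMap.snd ℝ _ _)) (y, (0 : Euc k)) :=
    ((hf.differentiable (by simp) y).hasFDerivAt.comp (y, (0 : Euc k)) hasFDerivAt_fst).add
      (j.hasFDerivAt.comp (y, (0 : Euc k)) hasFDerivAt_snd)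
  let D := (fderiv ℝ f y).comp (ContinuousLinearMap.fst ℝ (Euc n) (Euc k)) +
      j.comp (ContinuousLinearMap.snd ℝ (Euc n) (Euc k))
  have hDinj : Function.Injective D.toLinearMap := by
    rw [injective_iff_map_eq_zero]
    rintro ⟨v, w⟩ hvw
    have hsum : fderiv ℝ f y v + j w = 0 := hvw
    have hmem : j w ∈ LinearMap.range (fderiv ℝ f y).toLinearMap ⊓ C :=
      ⟨⟨-v, by rw [map_neg]; exact neg_eq_of_add_eq_zero_right hsum⟩, Subtype.coe_prop _⟩
    rw [hC.inf_eq_bot, Submodule.mem_bot] at hmem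
    have hw : w = 0 := (ContinuousLinearEquiv.ofFinrankEq hrank).injective
      (Subtype.ext (hmem.trans (by simp)))
    rw [hmem, add_zero] at hsum
    exact Prod.ext (hy (hsum.trans (map_zero _).symm)) hw
  let D' : (Euc n × Euc k) ≃L[ℝ] Euc q :=
    (LinearEquiv.ofInjectiveOfFinrankEq D.toLinearMap hDinj (by
      rw [finrank_prod, finrank_euclideanSpace_fin, finrank_euclideanSpace_fin,
        finrank_euclideanSpace_fin, hq])).toContinuousLinearEquiv
  have hD' : HasFDerivAt H (D' : (Euc n × Euc k) →L[ℝ] Euc q) (y, (0 : Euc k)) := by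
    convert hH' using 1
    exact ContinuousLinearMap.ext fun p => rfl
  let e₀ := hH.contDiffAt.toOpenPartialHomeomorph H hD' (by simp)
  -- Restricting to points where the derivative of `H` is invertible makes the inverse smooth on the
  -- whole target.
  let V : Set (Euc n × Euc k) := fderiv ℝ H ⁻¹' range ((↑) : ((Euc n × Euc k) ≃L[ℝ] Euc q) → _)
  have hV : IsOpen V :=
    ContinuousLinearEquiv.isOpen.preimage (hH.continuous_fderiv (by simp))
  have he₀ : ∀ p, e₀ p = H p := fun p => rfl
  refine ⟨e₀.restrOpen V hV, ?_, hH.contDiffOn, ?_, fun z => ?_⟩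
  · rw [OpenPartialHomeomorph.restrOpen_source]
    exact ⟨hH.contDiffAt.mem_toOpenPartialHomeomorph_source hD' (by simp), D', hD'.fderiv.symm⟩
  · intro z hz
    have hsrc := (e₀.restrOpen V hV).map_target hz
    rw [OpenPartialHomeomorph.restrOpen_source] at hsrc
    obtain ⟨-, S, hS⟩ := hsrc
    refine ((e₀.restrOpen V hV).contDiffAt_symm hz (f₀' := S) ?_
      hH.contDiffAt).contDiffWithinAt
    change HasFDerivAt H _ _
    rw [hS]
    exact (hH.differentiable (by simp) _).hasFDerivAt
  · change f z + j 0 = f z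
    rw [map_zero, add_zero]

variable [IsManifold (𝓡 n) ∞ M]

/-- In the chart `Ψ` on the source and the inverse of the straightening on the target, the map is
the inclusion `z ↦ (z, 0)`. -/
theorem isSmoothEmbedding_comp_diffeomorph (hq : q = n + k) (Ψ : M ≃ₘ^∞⟮𝓡 n, 𝓡 n⟯ Euc n)
    {f : Euc n → Euc q} (hf : ContDiff ℝ ∞ f) (hemb : IsEmbedding f)
    (hinj : ∀ y, Function.Injective (fderiv ℝ f y)) :
    IsSmoothEmbedding (𝓡 n) (𝓡 q) ∞ (f ∘ Ψ) := by
  refine ⟨⟨Euc k, inferInstance, inferInstance, fun x => ?_⟩,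
    hemb.comp Ψ.toHomeomorph.isEmbedding⟩
  obtain ⟨e, hsrc, he, he', hef⟩ := exists_local_straightening hq hf (hinj (Ψ x))
  let D : (Euc n × Euc k) ≃L[ℝ] Euc q := ContinuousLinearEquiv.ofFinrankEq (by
    rw [finrank_prod, finrank_euclideanSpace_fin, finrank_euclideanSpace_fin,
      finrank_euclideanSpace_fin, hq])
  let cod : OpenPartialHomeomorph (Euc q) (Euc q) :=
    e.symm.trans D.toHomeomorph.toOpenPartialHomeomorph
  have hcod_source : cod.source = e.target := by simp [cod]
  have hcod_target : cod.target = D.symm ⁻¹' e.source := by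
    simp [cod]
  let S : Set M := {z | (Ψ z, (0 : Euc k)) ∈ e.source}
  have hS : IsOpen S := e.open_source.preimage (Ψ.continuous.prodMk continuous_const)
  let dom : OpenPartialHomeomorph M (Euc n) :=
    Ψ.toHomeomorph.toOpenPartialHomeomorph.restrOpen S hS
  have hdom_source : dom.source = S := by simp [dom]
  refine IsImmersionAtOfComplement.mk_of_charts D dom cod ?_ ?_ ?_ ?_ ?_ ?_
  · rw [hdom_source]; exact hsrc
  · rw [hcod_source, Function.comp_apply, ← hef]
    exact e.map_source hsrc
  · exact dom.mem_maximalAtlas_of_contMDiffOn Ψ.contMDiff.contMDiffOn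
      Ψ.symm.contMDiff.contMDiffOn
  · refine cod.mem_maximalAtlas_of_contMDiffOn ?_ ?_
    · rw [contMDiffOn_iff_contDiffOn, hcod_source]
      exact D.contDiff.comp_contDiffOn he'
    · rw [contMDiffOn_iff_contDiffOn, hcod_target]
      exact he.comp D.symm.contDiff.contDiffOn fun z hz => hz
  · rw [hdom_source, hcod_source]
    intro z hz
    rw [mem_preimage, Function.comp_apply, ← hef]
    exact e.map_source hz
  · intro z hz
    have hz' : z ∈ dom.target := by simpa using hz
    have hzS : (z, (0 : Euc k)) ∈ e.source := by
      have := dom.map_target hz'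
      rw [hdom_source] at this
      change (Ψ (Ψ.symm z), (0 : Euc k)) ∈ e.source at this
      rwa [Ψ.apply_symm_apply] at this
    change D (e.symm (f (Ψ (Ψ.symm z)))) = D (z, 0)
    rw [Ψ.apply_symm_apply, ← hef, e.left_inv hzS]

end Immersion

/-! ### Rescaled actions, compact sets meeting all orbits, and the conclusion. -/

section Final

variable {n q : ℕ}

/-- Conjugating an isometric action by a homothety gives an isometric action. -/
theorem exists_action_smul {Γ : Type*} [Group Γ] (ρ : Γ →* (Euc q ≃ᵃⁱ[ℝ] Euc q)) {ε : ℝ}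
    (hε : ε ≠ 0) :
    ∃ ρ' : Γ →* (Euc q ≃ᵃⁱ[ℝ] Euc q), ∀ γ z, ρ' γ (ε • z) = ε • ρ γ z := by
  have hdist : ∀ (γ : Γ), Isometry fun z : Euc q => ε • ρ γ (ε⁻¹ • z) := fun γ =>
    Isometry.of_dist_eq fun z w => by
      rw [dist_smul₀, (ρ γ).dist_map, dist_smul₀, ← mul_assoc, ← norm_mul, mul_inv_cancel₀ hε,
        norm_one, one_mul]
  have hinv : ∀ (γ δ : Γ) (z : Euc q), γ * δ = 1 →
      ε • ρ γ (ε⁻¹ • ε • ρ δ (ε⁻¹ • z)) = z := by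
    intro γ δ z h
    have h1 : ρ γ (ρ δ (ε⁻¹ • z)) = ρ (γ * δ) (ε⁻¹ • z) := by rw [map_mul]; rfl
    rw [inv_smul_smul₀ hε, h1, h, map_one]
    exact smul_inv_smul₀ hε z
  let φ : Γ → (Euc q ≃ᵃⁱ[ℝ] Euc q) := fun γ =>
    (IsometryEquiv.mk' (fun z => ε • ρ γ (ε⁻¹ • z)) (fun z => ε • ρ γ⁻¹ (ε⁻¹ • z))
      (fun z => hinv γ γ⁻¹ z (mul_inv_cancel γ)) (hdist γ)).toRealAffineIsometryEquiv
  have hφ : ∀ γ z, φ γ z = ε • ρ γ (ε⁻¹ • z) := fun γ z => rfl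
  refine ⟨{ toFun := φ, map_one' := ?_, map_mul' := fun γ δ => ?_ }, fun γ z => ?_⟩
  · refine AffineIsometryEquiv.ext fun z => ?_
    rw [hφ, map_one]
    exact smul_inv_smul₀ hε z
  · refine AffineIsometryEquiv.ext fun z => ?_
    change φ (γ * δ) z = φ γ (φ δ z)
    rw [hφ, hφ, hφ, inv_smul_smul₀ hε, map_mul]
    rfl
  · change φ γ (ε • z) = _
    rw [hφ, inv_smul_smul₀ hε]

/-- A cocompact action on a weakly locally compact space has a compact set meeting all orbits. -/
theorem exists_isCompact_meeting_orbits {Γ X : Type*} [Group Γ] [TopologicalSpace X]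
    [WeaklyLocallyCompactSpace X] [MulAction Γ X] [ContinuousConstSMul Γ X]
    [CompactSpace (MulAction.orbitRel.Quotient Γ X)] :
    ∃ K : Set X, IsCompact K ∧ ∀ x, ∃ γ : Γ, γ • x ∈ K := by
  have hopen : IsOpenMap (Quotient.mk (MulAction.orbitRel Γ X)) := isOpenMap_quotient_mk'_mul
  choose N hN hxN using fun x : X => exists_compact_mem_nhds x
  obtain ⟨t, ht⟩ := (isCompact_univ (X := MulAction.orbitRel.Quotient Γ X)).elim_finite_subcover
    (fun x : X => Quotient.mk (MulAction.orbitRel Γ X) '' interior (N x))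
    (fun x => hopen _ isOpen_interior) fun z _ => by
      obtain ⟨x, rfl⟩ := Quotient.exists_rep z
      exact mem_iUnion.2 ⟨x, x, mem_interior_iff_mem_nhds.2 (hxN x), rfl⟩
  refine ⟨⋃ x ∈ t, N x, t.isCompact_biUnion fun x _ => hN x, fun y => ?_⟩
  obtain ⟨x, hx, z, hz, hzy⟩ := mem_iUnion₂.1 (ht (mem_univ (Quotient.mk _ y)))
  obtain ⟨γ, hγ⟩ := (MulAction.orbitRel_apply.1 (Quotient.exact hzy) : z ∈ MulAction.orbit Γ y)
  refine ⟨γ, mem_iUnion₂.2 ⟨x, hx, interior_subset ?_⟩⟩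
  change γ • y = z at hγ
  rwa [hγ]

end Final

end EquivariantEmbedding

end

theorem lemma2p1 {n : ℕ} {M : Type*} [TopologicalSpace M]
    [ChartedSpace (EquivariantEmbedding.Euc n) M] [IsManifold (𝓡 n) ∞ M]
    (hM : Nonempty (M ≃ₘ^∞⟮𝓡 n, 𝓡 n⟯ EquivariantEmbedding.Euc n))
    (g : EquivariantEmbedding.RiemMetric n M)
    {Γ : Type*} [Group Γ] (hΓ : EquivariantEmbedding.IsBieberbachGroup n Γ)
    [MulAction Γ M] [ProperlyDiscontinuousSMul Γ M]
    [CompactSpace (MulAction.orbitRel.Quotient Γ M)]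
    (hg : EquivariantEmbedding.ActsByIsometries Γ g) :
    ∃ u₀ : M → EquivariantEmbedding.Euc (EquivariantEmbedding.s n + 2 * n),
      IsSmoothEmbedding (𝓡 n) (𝓡 (EquivariantEmbedding.s n + 2 * n)) ∞ u₀ ∧
      EquivariantEmbedding.IsFreeMap n u₀ ∧
      EquivariantEmbedding.IsEquivariant Γ u₀ ∧
      EquivariantEmbedding.IsShort g u₀ := by
  open EquivariantEmbedding in
  obtain ⟨Ψ⟩ := hM
  have : WeaklyLocallyCompactSpace M :=
    ⟨fun x => ⟨Ψ ⁻¹' Metric.closedBall (Ψ x) 1,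
      Ψ.toHomeomorph.isCompact_preimage.2 (isCompact_closedBall _ _),
      Ψ.continuous.continuousAt.preimage_mem_nhds (Metric.closedBall_mem_nhds _ one_pos)⟩⟩
  have : ContinuousConstSMul Γ M := ⟨fun γ => (hg γ).1.continuous⟩
  obtain ⟨K, hK, hcov⟩ := exists_isCompact_meeting_orbits (Γ := Γ) (X := M)
  -- The action is conjugated by `Ψ`, which makes `Ψ` equivariant and preserves smoothness, proper
  -- discontinuity and cocompactness.
  let _ : MulAction Γ (Euc n) := Ψ.toEquiv.symm.mulAction Γ
  have hsmul : ∀ (γ : Γ) (y : Euc n), γ • y = Ψ (γ • Ψ.symm y) := fun _ _ => rfl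
  have hsmul' : ∀ (γ : Γ) (x : M), Ψ (γ • x) = γ • Ψ x := fun γ x => by
    rw [hsmul, Ψ.symm_apply_apply]
  have : ProperlyDiscontinuousSMul Γ (Euc n) := ⟨fun {A B} hA hB => by
    refine (ProperlyDiscontinuousSMul.finite_disjoint_inter_image (Γ := Γ)
      (hA.image Ψ.symm.continuous) (hB.image Ψ.symm.continuous)).subset ?_
    rintro γ ⟨_, ⟨y, hy, rfl⟩, hB⟩
    refine ⟨γ • Ψ.symm y, ⟨Ψ.symm y, ⟨y, hy, rfl⟩, rfl⟩, γ • y, hB, ?_⟩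
    rw [hsmul, Ψ.symm_apply_apply]⟩
  have hsm : ∀ γ : Γ, ContDiff ℝ ∞ (fun y : Euc n => γ • y) := fun γ => by
    rw [← contMDiff_iff_contDiff]
    exact Ψ.contMDiff.comp ((hg γ).1.comp Ψ.symm.contMDiff)
  obtain ⟨u, ρ, hu, hemb, hfree, hequiv⟩ := exists_equivariant_free_embedding hsm
    ⟨Ψ '' K, hK.image Ψ.continuous, fun y => by
      obtain ⟨γ, hγ⟩ := hcov (Ψ.symm y)
      exact ⟨γ, γ • Ψ.symm y, hγ, rfl⟩⟩ hΓ
  have huM : ContMDiff (𝓡 n) (𝓡 (s n + 2 * n)) ∞ (u ∘ Ψ) := hu.contMDiff.comp Ψ.contMDiff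
  have hequivM : ∀ (γ : Γ) (x : M), (u ∘ Ψ) (γ • x) = ρ γ ((u ∘ Ψ) x) := fun γ x => by
    rw [Function.comp_apply, hsmul', hequiv]
    rfl
  obtain ⟨ε, hε, hshort⟩ := exists_isShort_smul hg huM hequivM hK hcov
  obtain ⟨ρ', hρ'⟩ := exists_action_smul ρ hε.ne'
  have hεu : ContDiff ℝ ∞ (fun y => ε • u y) := hu.const_smul ε
  have hεfree : ∀ y, LinearIndependent ℝ (jet (fun y => ε • u y) y) := fun y => by
    have := linearIndependent_jet_affine hu
      (ε • ContinuousLinearMap.id ℝ (Euc (s n + 2 * n)))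
      (fun v w h => smul_right_injective _ hε.ne' (by simpa using h)) 0 (hfree y)
    simpa using this
  refine ⟨(fun y => ε • u y) ∘ Ψ, ?_, isFreeMap_comp_diffeomorph Ψ hεu hεfree,
    ⟨ρ', fun γ x => ?_⟩, hshort⟩
  · exact isSmoothEmbedding_comp_diffeomorph (k := s n + n) (by ring) Ψ hεu
      ((Homeomorph.smulOfNeZero ε hε.ne').isEmbedding.comp hemb.isEmbedding) fun y =>
        injective_fderiv_of_linearIndependent_jet hεu.contDiffAt (hεfree y)
  · change ε • (u ∘ Ψ) (γ • x) = ρ' γ (ε • (u ∘ Ψ) x)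
    rw [hequivM, hρ']
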